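/- **Conventions.** Let $\mathscr{A},\mathscr{B}$ be bicategories and $T\colon\mathscr{A}\to\mathscr{B}$ a pseudofunctor. The constraint 2-cells of the bicategories and of all pseudofunctors are suppressed. For a pseudofunctor $\mathfrak{M}_{(-)}\colon\mathscr{B}^{\mathrm{op}}\to\mathbf{Cat}$ let $\int\mathfrak{M}$ be its Grothendieck construction: the bicategory whose objects are pairs $(X\in\mathscr{B},\,m\in\mathfrak{M}_X)$, whose 1-cells $(X,m)\to(Y,n)$ are pairs of a 1-cell $f\colon X\to Y$ and a morphism $\alpha\colon m\to\mathfrak{M}_f(n)$ in $\mathfrak{M}_X$, and whose 2-cells $(f,\alpha)\Rightarrow(g,\beta)$ are the 2-cells $\nu\colon f\Rightarrow g$ with $(\mathfrak{M}_\nu)_n\cdot\alpha=\beta$. The 1-cell $(f,\alpha)$ is cartesian if $\alpha$ is invertible. Let $V\colon\int\mathfrak{M}\to\mathscr{B}$ be the projection. For a pseudofunctor $P\colon\mathfrak{N}\to\mathscr{A}$ on a category $\mathfrak{N}$ and $C\in\mathscr{A}$, let $\int_{\mathrm{lax}}^{m\in\mathfrak{N}}\mathscr{A}(P_m,C)$ be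 the category whose objects are pairs $(m\in\mathfrak{N},\,x\colon P_m\to C)$ and whose morphisms $(m,x)\to(n,y)$ are pairs of a morphism $u\colon m\to n$ in $\mathfrak{N}$ and a 2-cell $x\Rightarrow y\cdot P_u$. **Lax familial.** $T$ is *lax familial* if there are pseudofunctors $\mathfrak{M}_{(-)}\colon\mathscr{B}^{\mathrm{op}}\to\mathbf{Cat}$ and $\mathbf{P}\colon\int\mathfrak{M}\to\mathscr{A}$ and equivalences $$\int_{\mathrm{lax}}^{m\in\mathfrak{M}_X}\mathscr{A}(P^X_m,C)\;\simeq\;\mathscr{B}(X,TC),$$ natural in $C\in\mathscr{A}$ and in $X\in\mathscr{B}$, where $P^X$ is the restriction of $\mathbf{P}$ to the fibre $\mathfrak{M}_X$. Explicitly: there is a lax natural transformation $\eta$ from $V$ to $T\mathbf{P}$, with components $\eta_{X,m}\colon X\to TP^X_m$ and 2-cells $\eta_{\varphi}\colon T\mathbf{P}\varphi\cdot\eta_{X,m}\Rightarrow\eta_{Y,n}\cdot f$ for $\varphi=(f,\alpha)\colon(X,m)\to(Y,n)$, such that $\eta_\varphi$ is invertible whenever $\varphi$ is cartesian, and such that for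 all $X$ and $C$ the functor $(m,x)\mapsto Tx\cdot\eta_{X,m}$ (acting on morphisms through the 2-cells $\eta_{(1_X,u)}$) is an equivalence $\int_{\mathrm{lax}}^{m\in\mathfrak{M}_X}\mathscr{A}(P^X_m,C)\to\mathscr{B}(X,TC)$. **Lax-generic 1-cells.** A 1-cell $\delta\colon X\to TA$ is *lax-generic* if for all $z\colon X\to TB$, $f\colon A\to C$, $g\colon B\to C$ and every 2-cell $\alpha\colon Tf\cdot\delta\Rightarrow Tg\cdot z$ there are $h\colon A\to B$, $\gamma\colon Th\cdot\delta\Rightarrow z$ and $\nu\colon f\Rightarrow g\cdot h$ such that $\alpha=(Tg\,\gamma)\cdot(T\nu\,\delta)$ and 1. for all $\omega,\tau\colon k\Rightarrow h$, if $\gamma\cdot(T\omega\,\delta)=\gamma\cdot(T\tau\,\delta)$ then $\omega=\tau$; 2. for all $k\colon A\to B$, $\phi\colon Tk\cdot\delta\Rightarrow z$ and $\psi\colon f\Rightarrow g\cdot k$ with $\alpha=(Tg\,\phi)\cdot(T\psi\,\delta)$ there is $\overline\psi\colon k\Rightarrow h$ with $\phi=\gamma\cdot(T\overline\psi\,\delta)$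 and $\nu=(g\,\overline\psi)\cdot\psi$; 3. if $\alpha$ is invertible, then so are $\gamma$ and $\nu$. **Generic cells.** Let $\delta\colon X\to TA$ be lax-generic. A pair of $h\colon A\to B$ and $\gamma\colon Th\cdot\delta\Rightarrow z$, with $z\colon X\to TB$, is a *generic cell* if condition 1 above holds and, for all $k\colon A\to B$, $\phi\colon Tk\cdot\delta\Rightarrow z$ and $\lambda\colon h\Rightarrow k$ with $\gamma=\phi\cdot(T\lambda\,\delta)$, there is $\lambda^*\colon k\Rightarrow h$ with $\phi=\gamma\cdot(T\lambda^*\,\delta)$ and $\lambda^*\lambda=\mathrm{id}_h$. **Theorem.** Let $T\colon\mathscr{A}\to\mathscr{B}$ be a pseudofunctor of bicategories. The following are equivalent: 1. $T$ is lax familial; 2. both of the following hold: (a) for every $X\in\mathscr{B}$, $C\in\mathscr{A}$ and 1-cell $y\colon X\to TC$ there are a lax-generic 1-cell $\delta\colon X\to TA$ and a 1-cell $f\colon A\to C$ with $Tf\cdot\delta\cong y$; (b) for all lax-generic $\delta\colon X\to TA$, $\sigma\colon Y\to TB$, $\omega\colon Z\to TC$, all 1-cells $f\colon X\to Y$, $g\colon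 Y\to Z$, and all generic cells $(h,\theta)$ with $\theta\colon Th\cdot\delta\Rightarrow\sigma\cdot f$ and $(k,\phi)$ with $\phi\colon Tk\cdot\sigma\Rightarrow\omega\cdot g$, the pasting $(kh,\ \phi f\cdot Tk\,\theta)$ is a generic cell. -/

import Mathlib

open CategoryTheory Bicategory Opposite Bicategory.Opposite

universe w₁ w₂ v₁ v₂ u₁ u₂ v' u'

namespace LaxFamilial

section Elements

variable {B : Type u₂} [Bicategory.{w₂, v₂} B] (M : Bᵒᵖ ⥤ᵖ Cat.{v', u'})

/-- The reindexing functor `M_f : M_Y ⥤ M_X` along `f : X ⟶ Y`. -/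
abbrev pull {X Y : B} (f : X ⟶ Y) : M.obj (op Y) ⥤ M.obj (op X) :=
  (M.map f.op).toFunctor

/-- The natural transformation `M_f ⟶ M_g` induced by a 2-cell `f ⟶ g`. -/
abbrev pull₂ {X Y : B} {f g : X ⟶ Y} (ν : f ⟶ g) : pull M f ⟶ pull M g :=
  (M.map₂ (op2 ν)).toNatTrans

/-- The unit constraint of `M`. -/
abbrev pullId (X : B) : pull M (𝟙 X) ≅ 𝟭 (M.obj (op X)) :=
  Cat.Hom.toNatIso (M.mapId (op X))

/-- The composition constraint of `M`. -/
abbrev pullComp {X Y Z : B} (f : X ⟶ Y) (g : Y ⟶ Z) :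
    pull M (f ≫ g) ≅ pull M g ⋙ pull M f :=
  Cat.Hom.toNatIso (M.mapComp g.op f.op)

/-- Objects of the Grothendieck construction `∫ M` of a contravariant pseudofunctor
`M : Bᵒᵖ ⥤ᵖ Cat` on a bicategory: pairs of an object `X` of `B` and an object of `M_X`. -/
structure El where
  /-- The underlying object of `B`. -/
  base : B
  /-- The object of the fibre. -/
  fiber : M.obj (op base)

namespace El

variable {M}

/-- 1-cells `(X, m) ⟶ (Y, n)` of `∫ M`: a 1-cell `f : X ⟶ Y` and a morphism `m ⟶ M_f n`. Such a
1-cell is cartesian when `fiber` is invertible. -/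
structure Hom₁ (x y : El M) where
  base : x.base ⟶ y.base
  fiber : x.fiber ⟶ (pull M base).obj y.fiber

instance : CategoryStruct (El M) where
  Hom x y := Hom₁ x y
  id x := ⟨𝟙 x.base, (pullId M x.base).inv.app x.fiber⟩
  comp {_ _ z} φ ψ := ⟨φ.base ≫ ψ.base,
    φ.fiber ≫ (pull M φ.base).map ψ.fiber ≫ (pullComp M φ.base ψ.base).inv.app z.fiber⟩

/-- 2-cells `(f, α) ⟶ (g, β)` of `∫ M`: 2-cells `ν : f ⟶ g` of `B` such that `α` followed by the
component of `M_ν` is `β`. -/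
@[ext]
structure Hom₂ {x y : El M} (φ ψ : x ⟶ y) where
  base : φ.base ⟶ ψ.base
  w : φ.fiber ≫ (pull₂ M base).app y.fiber = ψ.fiber

@[simp] lemma id_base (x : El M) : (𝟙 x : x ⟶ x).base = 𝟙 x.base := rfl
@[simp] lemma id_fiber (x : El M) :
    (𝟙 x : x ⟶ x).fiber = (pullId M x.base).inv.app x.fiber := rfl
@[simp] lemma comp_base {x y z : El M} (φ : x ⟶ y) (ψ : y ⟶ z) :
    (φ ≫ ψ).base = φ.base ≫ ψ.base := rfl
@[simp] lemma comp_fiber {x y z : El M} (φ : x ⟶ y) (ψ : y ⟶ z) :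
    (φ ≫ ψ).fiber = φ.fiber ≫ (pull M φ.base).map ψ.fiber ≫
      (pullComp M φ.base ψ.base).inv.app z.fiber := rfl

lemma pull₂_id {X Y : B} (f : X ⟶ Y) : pull₂ M (𝟙 f) = 𝟙 (pull M f) := by
  simp [pull₂, op2_id]

lemma pull₂_comp {X Y : B} {f g h : X ⟶ Y} (μ : f ⟶ g) (ν : g ⟶ h) :
    pull₂ M (μ ≫ ν) = pull₂ M μ ≫ pull₂ M ν := by
  simp [pull₂, op2_comp]

instance homCategory (x y : El M) : Category (x ⟶ y) where
  Hom φ ψ := Hom₂ φ ψ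
  id φ := ⟨𝟙 φ.base, by simp [pull₂_id]⟩
  comp μ ν := ⟨μ.base ≫ ν.base, by rw [pull₂_comp, NatTrans.comp_app, reassoc_of% μ.w, ν.w]⟩
  id_comp _ := Hom₂.ext (Category.id_comp _)
  comp_id _ := Hom₂.ext (Category.comp_id _)
  assoc _ _ _ := Hom₂.ext (Category.assoc _ _ _)

@[simp] lemma id₂_base {x y : El M} (φ : x ⟶ y) : (𝟙 φ : φ ⟶ φ).base = 𝟙 φ.base := rfl
@[simp] lemma comp₂_base {x y : El M} {φ ψ χ : x ⟶ y} (μ : φ ⟶ ψ) (ν : ψ ⟶ χ) :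
    (μ ≫ ν).base = μ.base ≫ ν.base := rfl

@[ext]
lemma hom₂_ext {x y : El M} {φ ψ : x ⟶ y} {μ ν : φ ⟶ ψ} (h : μ.base = ν.base) : μ = ν :=
  Hom₂.ext h

/-- An invertible 2-cell of `∫ M` from an invertible 2-cell of `B`. -/
@[simps]
def isoMk {x y : El M} {φ ψ : x ⟶ y} (e : φ.base ≅ ψ.base)
    (h : φ.fiber ≫ (pull₂ M e.hom).app y.fiber = ψ.fiber) : φ ≅ ψ where
  hom := ⟨e.hom, h⟩
  inv := ⟨e.inv, by
    rw [← h, Category.assoc, ← NatTrans.comp_app, ← pull₂_comp, e.hom_inv_id, pull₂_id]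
    simp⟩
  hom_inv_id := hom₂_ext e.hom_inv_id
  inv_hom_id := hom₂_ext e.inv_hom_id

lemma pull₂_whiskerLeft {X Y Z : B} (f : X ⟶ Y) {g h : Y ⟶ Z} (ν : g ⟶ h) (n) :
    (pullComp M f g).inv.app n ≫ (pull₂ M (f ◁ ν)).app n =
      (pull M f).map ((pull₂ M ν).app n) ≫ (pullComp M f h).inv.app n := by
  simp [pull₂, op2_whiskerLeft]

lemma pull₂_whiskerRight {X Y Z : B} {f g : X ⟶ Y} (ν : f ⟶ g) (h : Y ⟶ Z) (n) :
    (pullComp M f h).inv.app n ≫ (pull₂ M (ν ▷ h)).app n =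
      (pull₂ M ν).app ((pull M h).obj n) ≫ (pullComp M g h).inv.app n := by
  simp [pull₂, op2_whiskerRight]

lemma pull₂_associator {X Y Z W : B} (f : X ⟶ Y) (g : Y ⟶ Z) (h : Z ⟶ W) (n) :
    (pullComp M f g).inv.app ((pull M h).obj n) ≫
      (pullComp M (f ≫ g) h).inv.app n ≫ (pull₂ M (α_ f g h).hom).app n =
      (pull M f).map ((pullComp M g h).inv.app n) ≫ (pullComp M f (g ≫ h)).inv.app n :=
  (M.mapComp_assoc_left_inv_app h.op g.op f.op n) |>.symm

lemma pull₂_leftUnitor {X Y : B} (f : X ⟶ Y) (n) :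
    (pullId M X).inv.app ((pull M f).obj n) ≫ (pullComp M (𝟙 X) f).inv.app n ≫
      (pull₂ M (λ_ f).hom).app n = 𝟙 _ := by
  have := M.mapComp_id_right_inv_app f.op n
  simp [pull₂] at this ⊢

lemma pull₂_rightUnitor {X Y : B} (f : X ⟶ Y) (n) :
    (pull M f).map ((pullId M Y).inv.app n) ≫ (pullComp M f (𝟙 Y)).inv.app n ≫
      (pull₂ M (ρ_ f).hom).app n = 𝟙 _ := by
  simp [pull₂, pull, ← Functor.map_comp]

/-- The bicategory `∫ M`. -/
instance bicategory : Bicategory (El M) where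
  homCategory x y := homCategory x y
  whiskerLeft φ _ _ ν := ⟨φ.base ◁ ν.base, by
    simp only [comp_fiber, Category.assoc]
    erw [pull₂_whiskerLeft]
    rw [← ν.w, Functor.map_comp_assoc]⟩
  whiskerRight ν χ := ⟨ν.base ▷ χ.base, by
    simp only [comp_fiber, Category.assoc]
    erw [pull₂_whiskerRight]
    rw [← ν.w, Category.assoc, NatTrans.naturality_assoc]⟩
  associator φ ψ χ := isoMk (α_ φ.base ψ.base χ.base) (by
    simp only [comp_fiber, comp_base, Category.assoc, Functor.map_comp]
    rw [← pull₂_associator]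
    simp only [← NatTrans.naturality_assoc]
    rfl)
  leftUnitor φ := isoMk (λ_ φ.base) (by
    have := pull₂_leftUnitor φ.base (M := M)
    simp only [comp_fiber, id_fiber, id_base, Category.assoc]
    rw [← NatTrans.naturality_assoc, this]
    exact Category.comp_id _)
  rightUnitor φ := isoMk (ρ_ φ.base) (by
    simp only [comp_fiber, id_fiber, id_base, Category.assoc]
    rw [pull₂_rightUnitor]
    exact Category.comp_id _)
  whiskerLeft_id _ _ := hom₂_ext (Bicategory.whiskerLeft_id _ _)
  whiskerLeft_comp _ _ _ _ _ _ := hom₂_ext (Bicategory.whiskerLeft_comp _ _ _)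
  id_whiskerLeft _ := hom₂_ext (Bicategory.id_whiskerLeft _)
  comp_whiskerLeft _ _ _ _ _ := hom₂_ext (Bicategory.comp_whiskerLeft _ _ _)
  id_whiskerRight _ _ := hom₂_ext (Bicategory.id_whiskerRight _ _)
  comp_whiskerRight _ _ _ := hom₂_ext (Bicategory.comp_whiskerRight _ _ _)
  whiskerRight_id _ := hom₂_ext (Bicategory.whiskerRight_id _)
  whiskerRight_comp _ _ _ := hom₂_ext (Bicategory.whiskerRight_comp _ _ _)
  whisker_assoc _ _ _ _ _ := hom₂_ext (Bicategory.whisker_assoc _ _ _)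
  whisker_exchange _ _ := hom₂_ext (Bicategory.whisker_exchange _ _)
  pentagon _ _ _ _ := hom₂_ext (Bicategory.pentagon _ _ _ _)
  triangle _ _ := hom₂_ext (Bicategory.triangle _ _)

variable (M)

/-- The projection `∫ M ⥤ᵖ B`. -/
def proj : El M ⥤ᵖ B where
  obj x := x.base
  map φ := φ.base
  map₂ ν := ν.base
  mapId x := Iso.refl _
  mapComp φ ψ := Iso.refl _
  map₂_whisker_left _ _ _ _ := by simp; rfl
  map₂_whisker_right _ _ := by simp; rfl
  map₂_associator _ _ _ := by simp; rfl
  map₂_left_unitor _ := by simp; rfl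
  map₂_right_unitor _ := by simp; rfl

lemma pull₂_leftUnitor_inv {X Y : B} (f : X ⟶ Y) (n) :
    (pull₂ M (λ_ f).inv).app n =
      (pullId M X).inv.app ((pull M f).obj n) ≫ (pullComp M (𝟙 X) f).inv.app n := by
  have h := pull₂_leftUnitor f n (M := M)
  have h' : (pull₂ M (λ_ f).hom).app n ≫ (pull₂ M (λ_ f).inv).app n = 𝟙 _ := by
    rw [← NatTrans.comp_app, ← pull₂_comp, Iso.hom_inv_id, pull₂_id]; rfl
  have := congrArg (· ≫ (pull₂ M (λ_ f).inv).app n) h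
  simp only [Category.assoc, h'] at this
  simpa using this.symm

variable {X : B}

/-- The inclusion `M_X ⟶ ∫ M` on morphisms. -/
def inclMap {m n : M.obj (op X)} (u : m ⟶ n) : (⟨X, m⟩ : El M) ⟶ ⟨X, n⟩ :=
  ⟨𝟙 X, u ≫ (pullId M X).inv.app n⟩

lemma inclMap_eqToHom_base {m n : M.obj (op X)} {u v : m ⟶ n} (e : u = v)
    (h : inclMap M u = inclMap M v) : (eqToHom h).base = 𝟙 (𝟙 X) := by
  subst e; rfl

/-- The unit constraint of the inclusion `M_X ⟶ ∫ M`. -/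
def inclId (m : M.obj (op X)) : inclMap M (𝟙 m) ≅ 𝟙 (⟨X, m⟩ : El M) :=
  isoMk (Iso.refl (𝟙 X)) (by simp [inclMap, pull₂_id])

/-- The composition constraint of the inclusion `M_X ⟶ ∫ M`. -/
def inclComp {m n p : M.obj (op X)} (u : m ⟶ n) (v : n ⟶ p) :
    inclMap M (u ≫ v) ≅ inclMap M u ≫ inclMap M v :=
  isoMk (λ_ (𝟙 X)).symm (by
    simp only [inclMap, comp_fiber, Category.assoc, Iso.symm_hom, Functor.map_comp]
    rw [pull₂_leftUnitor_inv, ← NatTrans.naturality_assoc, ← NatTrans.naturality_assoc]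
    rfl)

/-- The inclusion of the fibre `M_X` into `∫ M`, as a pseudofunctor on the category `M_X`. -/
def incl (X : B) : LocallyDiscrete (M.obj (op X)) ⥤ᵖ El M :=
  LocallyDiscrete.mkPseudofunctor
    (fun m => ⟨X, m⟩)
    (fun u => inclMap M u)
    (fun m => inclId M m)
    (fun u v => inclComp M u v)
    (fun f g h => hom₂_ext (by
      rw [inclMap_eqToHom_base M (by simp)]
      change (λ_ (𝟙 X)).inv ≫ (λ_ (𝟙 X)).inv ▷ 𝟙 X ≫ (α_ _ _ _).hom ≫
        𝟙 X ◁ (λ_ (𝟙 X)).hom ≫ (λ_ (𝟙 X)).hom = 𝟙 (𝟙 X)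
      bicategory))
    (fun f => hom₂_ext (by
      rw [inclMap_eqToHom_base M (by simp)]
      change (λ_ (𝟙 X)).inv ≫ 𝟙 (𝟙 X) ▷ 𝟙 X ≫ (λ_ (𝟙 X)).hom = 𝟙 (𝟙 X)
      bicategory))
    (fun f => hom₂_ext (by
      rw [inclMap_eqToHom_base M (by simp)]
      change (λ_ (𝟙 X)).inv ≫ 𝟙 X ◁ 𝟙 (𝟙 X) ≫ (ρ_ (𝟙 X)).hom = 𝟙 (𝟙 X)
      bicategory))
/-- The inclusion of the fibre over `X` followed by the projection is constant at `𝟙 X`. -/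
def inclBase {m n : LocallyDiscrete (M.obj (op X))} (u : m ⟶ n) :
    ((incl M X).map u).base ≅ 𝟙 X :=
  Iso.refl (𝟙 X)

end El
end Elements

section Cocone

variable {A : Type u₁} [Bicategory.{w₁, v₁} A] {B : Type u₂} [Bicategory.{w₂, v₂} B]
  {N : Type u'} [Category.{v'} N]

/-- Objects of the lax conical colimit `∫ A(Q_m, C)` over `m : N` of the categories `A(Q_m, C)`
(that is, of the Grothendieck construction of the contravariant pseudofunctor `m ↦ A(Q_m, C)`):
pairs of an index `m` and a 1-cell `Q_m ⟶ C`. -/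
structure Rep (Q : LocallyDiscrete N ⥤ᵖ A) (C : A) where
  idx : LocallyDiscrete N
  arr : Q.obj idx ⟶ C

namespace Rep
variable {Q : LocallyDiscrete N ⥤ᵖ A} {C : A}

/-- Morphisms `(m, x) ⟶ (n, y)`: a morphism `u : m ⟶ n` and a 2-cell from `x` to the composite of
`Q_u` and `y`. -/
structure Hom (x y : Rep Q C) where
  idx : x.idx ⟶ y.idx
  cell : x.arr ⟶ Q.map idx ≫ y.arr

lemma Hom.ext_of_cell {x y : Rep Q C} {φ ψ : Hom x y} (e : φ.idx ⟶ ψ.idx)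
    (h : φ.cell ≫ Q.map₂ e ▷ y.arr = ψ.cell) : φ = ψ := by
  obtain ⟨u, μ⟩ := φ
  obtain ⟨v, ν⟩ := ψ
  obtain rfl : u = v := LocallyDiscrete.eq_of_hom e
  obtain rfl : e = 𝟙 u := Subsingleton.elim _ _
  dsimp only at h
  rw [Q.map₂_id, id_whiskerRight, Category.comp_id] at h
  rw [h]

instance : Category (Rep Q C) where
  Hom x y := Hom x y
  id x := ⟨𝟙 x.idx, (λ_ x.arr).inv ≫ (Q.mapId x.idx).inv ▷ x.arr⟩
  comp {x y z} φ ψ := ⟨φ.idx ≫ ψ.idx,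
    φ.cell ≫ Q.map φ.idx ◁ ψ.cell ≫ (α_ _ _ _).inv ≫
      (Q.mapComp φ.idx ψ.idx).inv ▷ z.arr⟩
  id_comp {x y} φ := Hom.ext_of_cell (λ_ φ.idx).hom (by
    obtain ⟨u, μ⟩ := φ
    dsimp only
    rw [Q.map₂_left_unitor]
    simp only [Category.assoc, comp_whiskerRight, leftUnitor_whiskerRight,
      inv_hom_whiskerRight_assoc]
    rw [← whisker_exchange_assoc]
    simp)
  comp_id {x y} φ := Hom.ext_of_cell (ρ_ φ.idx).hom (by
    obtain ⟨u, μ⟩ := φ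
    dsimp only
    rw [Q.map₂_right_unitor]
    simp)
  assoc {x y z t} φ ψ χ := Hom.ext_of_cell (α_ φ.idx ψ.idx χ.idx).hom (by
    dsimp only
    rw [Q.map₂_associator]
    simp only [Category.assoc, comp_whiskerRight, whiskerLeft_comp, inv_hom_whiskerRight_assoc]
    rw [← whisker_exchange_assoc]
    simp)

end Rep

/-- A lax cocone from the representables `A(Q_m, -)` to `B(X, T -)`, written through the Yoneda
lemma: 1-cells `X ⟶ T Q_m` and 2-cells indexed by the morphisms `m ⟶ n`, compatible with the
constraints of `Q` and `T`. -/
structure Cocone (T : A ⥤ᵖ B) (X : B) (Q : LocallyDiscrete N ⥤ᵖ A) where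
  app (m : LocallyDiscrete N) : X ⟶ T.obj (Q.obj m)
  cell {m n : LocallyDiscrete N} (u : m ⟶ n) : app m ≫ T.map (Q.map u) ⟶ app n
  cell_id (m : LocallyDiscrete N) :
    app m ◁ T.map₂ (Q.mapId m).inv ≫ cell (𝟙 m) =
      app m ◁ (T.mapId (Q.obj m)).hom ≫ (ρ_ (app m)).hom
  cell_comp {m n p : LocallyDiscrete N} (u : m ⟶ n) (v : n ⟶ p) :
    app m ◁ T.map₂ (Q.mapComp u v).inv ≫ cell (u ≫ v) =
      app m ◁ (T.mapComp (Q.map u) (Q.map v)).hom ≫ (α_ _ _ _).inv ≫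
        cell u ▷ T.map (Q.map v) ≫ cell v

/-- The comparison functor at `C` from the lax conical colimit of the `A(Q_m, C)` to `B(X, T C)`
induced by a lax cocone; it sends `(m, x)` to the composite `X ⟶ T Q_m ⟶ T C`. -/
def Cocone.comparison {T : A ⥤ᵖ B} {X : B} {Q : LocallyDiscrete N ⥤ᵖ A}
    (κ : Cocone T X Q) (C : A) : Rep Q C ⥤ (X ⟶ T.obj C) where
  obj x := κ.app x.idx ≫ T.map x.arr
  map {x y} φ := κ.app x.idx ◁ T.map₂ φ.cell ≫
    κ.app x.idx ◁ (T.mapComp (Q.map φ.idx) y.arr).hom ≫ (α_ _ _ _).inv ≫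
      κ.cell φ.idx ▷ T.map y.arr
  map_id x := by
    change κ.app x.idx ◁ T.map₂ ((λ_ x.arr).inv ≫ (Q.mapId x.idx).inv ▷ x.arr) ≫
      κ.app x.idx ◁ (T.mapComp (Q.map (𝟙 x.idx)) x.arr).hom ≫ (α_ _ _ _).inv ≫
      κ.cell (𝟙 x.idx) ▷ T.map x.arr = _
    have h := congrArg (· ▷ T.map x.arr) (κ.cell_id x.idx)
    simp only [comp_whiskerRight, whisker_assoc, Category.assoc] at h
    rw [Iso.cancel_iso_hom_left] at h
    rw [T.map₂_comp, T.map₂_whisker_right]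
    simp only [whiskerLeft_comp, Category.assoc, whiskerLeft_inv_hom_assoc, h]
    rw [T.mapComp_id_left_hom]
    have h1 : T.map₂ (λ_ x.arr).inv ≫ T.map₂ (λ_ x.arr).hom = 𝟙 _ := by
      rw [← T.map₂_comp, Iso.inv_hom_id, T.map₂_id]
    have h2 := congrArg (κ.app x.idx ◁ ·) h1
    simp only [whiskerLeft_comp] at h2
    simp only [whiskerLeft_comp, Category.assoc]
    rw [reassoc_of% h2]
    simp
  map_comp {x y z} φ ψ := by
    change κ.app x.idx ◁ T.map₂ (φ.cell ≫ Q.map φ.idx ◁ ψ.cell ≫ (α_ _ _ _).inv ≫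
      (Q.mapComp φ.idx ψ.idx).inv ▷ z.arr) ≫
      κ.app x.idx ◁ (T.mapComp (Q.map (φ.idx ≫ ψ.idx)) z.arr).hom ≫ (α_ _ _ _).inv ≫
      κ.cell (φ.idx ≫ ψ.idx) ▷ T.map z.arr = _
    have h := congrArg (· ▷ T.map z.arr) (κ.cell_comp φ.idx ψ.idx)
    simp only [comp_whiskerRight, whisker_assoc, Category.assoc] at h
    rw [Iso.cancel_iso_hom_left] at h
    have h2 : T.map₂ (α_ (Q.map φ.idx) (Q.map ψ.idx) z.arr).inv ≫
        (T.mapComp (Q.map φ.idx ≫ Q.map ψ.idx) z.arr).hom ≫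
          (T.mapComp (Q.map φ.idx) (Q.map ψ.idx)).hom ▷ T.map z.arr =
        (T.mapComp (Q.map φ.idx) (Q.map ψ.idx ≫ z.arr)).hom ≫
          T.map (Q.map φ.idx) ◁ (T.mapComp (Q.map ψ.idx) z.arr).hom ≫ (α_ _ _ _).inv := by
      rw [T.mapComp_assoc_right_hom_assoc]
      simp
    have h3 := congrArg (κ.app x.idx ◁ ·) h2
    simp only [whiskerLeft_comp] at h3
    simp only [T.map₂_comp, T.map₂_whisker_right, T.map₂_whisker_left, whiskerLeft_comp,
      Category.assoc, whiskerLeft_inv_hom_assoc, h]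
    rw [reassoc_of% h3]
    simp only [whiskerLeft_inv_hom_assoc]
    congr 2
    have h4 : κ.cell φ.idx ▷ T.map y.arr ≫ κ.app y.idx ◁ T.map₂ ψ.cell =
      _ ◁ T.map₂ ψ.cell ≫ κ.cell φ.idx ▷ _ := (whisker_exchange _ _).symm
    rw [reassoc_of% h4, ← whisker_exchange_assoc]
    simp

end Cocone

section Fibre

variable {A : Type u₁} [Bicategory.{w₁, v₁} A] {B : Type u₂} [Bicategory.{w₂, v₂} B]
  {T : A ⥤ᵖ B} {M : Bᵒᵖ ⥤ᵖ Cat.{v', u'}} {P : El M ⥤ᵖ A}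

variable (η : Lax.LaxTrans (El.proj M).toLax (P.comp T).toLax)

/-- The component at `x` of a lax transformation from the projection `∫ M ⥤ᵖ B` to `P` followed
by `T`. -/
abbrev leg (x : El M) : x.base ⟶ T.obj (P.obj x) := η.app x

/-- The 2-cell component of such a lax transformation. -/
def natCell {x y : El M} (φ : x ⟶ y) :
    leg η x ≫ T.map (P.map φ) ⟶ φ.base ≫ leg η y :=
  η.naturality φ

lemma natCell_naturality {x y : El M} {φ ψ : x ⟶ y} (σ : φ ⟶ ψ) :
    natCell η φ ≫ σ.base ▷ leg η y = leg η x ◁ T.map₂ (P.map₂ σ) ≫ natCell η ψ :=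
  η.naturality_naturality σ

lemma natCell_id (x : El M) :
    leg η x ◁ T.map₂ (P.mapId x).inv ≫ natCell η (𝟙 x) =
      leg η x ◁ (T.mapId (P.obj x)).hom ≫ (ρ_ _).hom ≫ (λ_ _).inv := by
  have h : leg η x ◁ ((T.mapId (P.obj x)).inv ≫ T.map₂ (P.mapId x).inv) ≫ natCell η (𝟙 x) =
    (ρ_ (leg η x)).hom ≫ (λ_ (leg η x)).inv ≫ 𝟙 (𝟙 x.base) ▷ leg η x := η.naturality_id x
  rw [whiskerLeft_comp, id_whiskerRight, Category.comp_id, Category.assoc] at h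
  rw [← h, whiskerLeft_hom_inv_assoc]

lemma natCell_comp {x y z : El M} (φ : x ⟶ y) (ψ : y ⟶ z) :
    leg η x ◁ T.map₂ (P.mapComp φ ψ).inv ≫ natCell η (φ ≫ ψ) =
      leg η x ◁ (T.mapComp (P.map φ) (P.map ψ)).hom ≫ (α_ _ _ _).inv ≫
        natCell η φ ▷ T.map (P.map ψ) ≫ (α_ _ _ _).hom ≫ φ.base ◁ natCell η ψ ≫ (α_ _ _ _).inv := by
  have h : leg η x ◁ ((T.mapComp (P.map φ) (P.map ψ)).inv ≫ T.map₂ (P.mapComp φ ψ).inv) ≫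
      natCell η (φ ≫ ψ) = (α_ _ _ _).inv ≫
        natCell η φ ▷ T.map (P.map ψ) ≫ (α_ _ _ _).hom ≫ φ.base ◁ natCell η ψ ≫ (α_ _ _ _).inv ≫
          𝟙 (φ.base ≫ ψ.base) ▷ leg η z := η.naturality_comp φ ψ
  rw [whiskerLeft_comp, id_whiskerRight, Category.comp_id, Category.assoc] at h
  rw [← h, whiskerLeft_hom_inv_assoc]

lemma natCell_id_of_iso {x : El M} {φ : x ⟶ x} (e : φ ≅ 𝟙 x) (b : φ.base ⟶ 𝟙 x.base)
    (h : e.inv.base ≫ b = 𝟙 _) :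
    leg η x ◁ T.map₂ ((P.mapId x).inv ≫ P.map₂ e.inv) ≫ natCell η φ ≫ b ▷ leg η x ≫ (λ_ _).hom =
      leg η x ◁ (T.mapId (P.obj x)).hom ≫ (ρ_ _).hom := by
  have h1 := natCell_naturality η e.inv
  have h2 := natCell_id η x
  rw [T.map₂_comp, whiskerLeft_comp, Category.assoc, ← reassoc_of% h1, reassoc_of% h2,
    ← comp_whiskerRight_assoc, h]
  simp

lemma natCell_comp_of_iso {X : B} {m n p : M.obj (op X)} {φ : (⟨X, m⟩ : El M) ⟶ ⟨X, n⟩}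
    {ψ : (⟨X, n⟩ : El M) ⟶ ⟨X, p⟩} {χ : (⟨X, m⟩ : El M) ⟶ ⟨X, p⟩} (e : χ ≅ φ ≫ ψ)
    (b : φ.base ⟶ 𝟙 X) (c : ψ.base ⟶ 𝟙 X) (d : χ.base ⟶ 𝟙 X)
    (h : e.inv.base ≫ d = b ▷ ψ.base ≫ (λ_ _).hom ≫ c) :
    leg η ⟨X, m⟩ ◁ T.map₂ ((P.mapComp φ ψ).inv ≫ P.map₂ e.inv) ≫
        natCell η χ ≫ d ▷ leg η ⟨X, p⟩ ≫ (λ_ _).hom =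
      leg η ⟨X, m⟩ ◁ (T.mapComp (P.map φ) (P.map ψ)).hom ≫ (α_ _ _ _).inv ≫
        (natCell η φ ≫ b ▷ leg η ⟨X, n⟩ ≫ (λ_ _).hom) ▷ T.map (P.map ψ) ≫
          natCell η ψ ≫ c ▷ leg η ⟨X, p⟩ ≫ (λ_ _).hom := by
  have h1 := natCell_naturality η e.inv
  have h2 := natCell_comp η φ ψ
  rw [T.map₂_comp, whiskerLeft_comp, Category.assoc, ← reassoc_of% h1, reassoc_of% h2,
    ← comp_whiskerRight_assoc, h]
  have h3 := whisker_exchange b (natCell η ψ)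
  simp only [whiskerRight_comp, Category.assoc] at h3
  simp only [comp_whiskerRight, Category.assoc, leftUnitor_whiskerRight]
  rw [reassoc_of% h3]
  simp

/-- The restriction to the fibre over `X` of such a lax transformation: a lax cocone on the
composite of `P` with the inclusion of the fibre `M_X` into `∫ M`. -/
def fibreCocone (X : B) : Cocone T X ((El.incl M X).comp P) where
  app m := leg η ((El.incl M X).obj m)
  cell {m n} u := natCell η ((El.incl M X).map u) ≫
    (El.inclBase M u).hom ▷ leg η ((El.incl M X).obj n) ≫ (λ_ _).hom
  cell_id m := natCell_id_of_iso η ((El.incl M X).mapId m) (El.inclBase M (𝟙 m)).hom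
    (Category.comp_id (𝟙 (𝟙 X)))
  cell_comp {m n p} u v := natCell_comp_of_iso η ((El.incl M X).mapComp u v)
    (El.inclBase M u).hom (El.inclBase M v).hom (El.inclBase M (u ≫ v)).hom (by
      change (λ_ (𝟙 X)).hom ≫ 𝟙 (𝟙 X) = 𝟙 (𝟙 X) ▷ 𝟙 X ≫ (λ_ (𝟙 X)).hom ≫ 𝟙 (𝟙 X)
      simp)

end Fibre

section Main

variable {A : Type u₁} [Bicategory.{w₁, v₁} A] {B : Type u₂} [Bicategory.{w₂, v₂} B]
  (T : A ⥤ᵖ B)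

/-- `T` is lax familial: there are pseudofunctors `M : Bᵒᵖ ⥤ᵖ Cat` and `P : ∫ M ⥤ᵖ A` and an
equivalence from the lax conical colimit of the representables `A(P(X, m), -)` over `m : M_X` to
`B(X, T -)`, natural in `X`.

The equivalence is given by its universal lax cocone: 1-cells `X ⟶ T P(X, m)` and 2-cells which form
a lax transformation `η` from the projection `∫ M ⥤ᵖ B` to `P` followed by `T`. The 2-cells of `η`
over the fibre `M_X` make a lax cocone, and its comparison functors have to be equivalences. The
2-cells of `η` at the cartesian 1-cells say how the equivalences for different `X` are related,
and naturality in `X` (up to coherent isomorphism) is the invertibility of these. -/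
def IsLaxFamilial : Prop :=
  ∃ (M : Bᵒᵖ ⥤ᵖ Cat.{v', u'}) (P : El M ⥤ᵖ A)
    (η : Lax.LaxTrans (El.proj M).toLax (P.comp T).toLax),
    (∀ (x y : El M) (φ : x ⟶ y), IsIso φ.fiber → IsIso (η.naturality φ)) ∧
    ∀ (X : B) (C : A), ((fibreCocone η X).comparison C).IsEquivalence

/-- The pasting of `γ : T h · δ ⟶ z` with `T ν`, for a 2-cell `ν : f ⟶ g · h`. -/
def paste {X : B} {A₁ A₂ C : A} {δ : X ⟶ T.obj A₁} {z : X ⟶ T.obj A₂} {f : A₁ ⟶ C}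
    {g : A₂ ⟶ C} {h : A₁ ⟶ A₂} (γ : δ ≫ T.map h ⟶ z) (ν : f ⟶ h ≫ g) :
    δ ≫ T.map f ⟶ z ≫ T.map g :=
  δ ◁ T.map₂ ν ≫ δ ◁ (T.mapComp h g).hom ≫ (α_ _ _ _).inv ≫ γ ▷ T.map g

/-- 2-cells into `h` are determined by their pasting with `γ`. -/
def IsSubterminal {X : B} {A₁ A₂ : A} {δ : X ⟶ T.obj A₁} {z : X ⟶ T.obj A₂} {h : A₁ ⟶ A₂}
    (γ : δ ≫ T.map h ⟶ z) : Prop :=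
  ∀ (k : A₁ ⟶ A₂) (ω τ : k ⟶ h), δ ◁ T.map₂ ω ≫ γ = δ ◁ T.map₂ τ ≫ γ → ω = τ

/-- `(h, γ, ν)` is a universal factorization of `α`. -/
structure IsUniversalFactorization {X : B} {A₁ A₂ C : A} {δ : X ⟶ T.obj A₁} {z : X ⟶ T.obj A₂}
    {f : A₁ ⟶ C} {g : A₂ ⟶ C} (α : δ ≫ T.map f ⟶ z ≫ T.map g) {h : A₁ ⟶ A₂}
    (γ : δ ≫ T.map h ⟶ z) (ν : f ⟶ h ≫ g) : Prop where
  fac : paste T γ ν = α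
  subterminal : IsSubterminal T γ
  lift : ∀ (k : A₁ ⟶ A₂) (φ : δ ≫ T.map k ⟶ z) (ψ : f ⟶ k ≫ g), paste T φ ψ = α →
    ∃ ψ' : k ⟶ h, δ ◁ T.map₂ ψ' ≫ γ = φ ∧ ψ ≫ ψ' ▷ g = ν

/-- Lax-generic 1-cells `X ⟶ T A₁`. -/
def IsLaxGeneric {X : B} {A₁ : A} (δ : X ⟶ T.obj A₁) : Prop :=
  ∀ (A₂ C : A) (z : X ⟶ T.obj A₂) (f : A₁ ⟶ C) (g : A₂ ⟶ C) (α : δ ≫ T.map f ⟶ z ≫ T.map g),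
    ∃ (h : A₁ ⟶ A₂) (γ : δ ≫ T.map h ⟶ z) (ν : f ⟶ h ≫ g),
      IsUniversalFactorization T α γ ν ∧ (IsIso α → IsIso γ ∧ IsIso ν)

/-- Generic cells `(h, γ)` out of a (lax-generic) 1-cell `δ`. -/
structure IsGenericCell {X : B} {A₁ A₂ : A} {δ : X ⟶ T.obj A₁} {z : X ⟶ T.obj A₂} {h : A₁ ⟶ A₂}
    (γ : δ ≫ T.map h ⟶ z) : Prop where
  subterminal : IsSubterminal T γ
  retract : ∀ (k : A₁ ⟶ A₂) (φ : δ ≫ T.map k ⟶ z) (l : h ⟶ k), δ ◁ T.map₂ l ≫ φ = γ →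
    ∃ l' : k ⟶ h, δ ◁ T.map₂ l' ≫ γ = φ ∧ l ≫ l' = 𝟙 h

/-- Every 1-cell `X ⟶ T C` factors, up to an invertible 2-cell, as a lax-generic 1-cell followed by
the image of a 1-cell under `T`. -/
def AdmitsLaxGenericFactorizations : Prop :=
  ∀ (X : B) (C : A) (y : X ⟶ T.obj C), ∃ (A₁ : A) (δ : X ⟶ T.obj A₁) (f : A₁ ⟶ C),
    IsLaxGeneric T δ ∧ Nonempty (δ ≫ T.map f ≅ y)

/-- The pasting of two horizontally adjacent squares. -/
def hpaste {X Y Z : B} {A₁ A₂ A₃ : A} {δ : X ⟶ T.obj A₁} {σ : Y ⟶ T.obj A₂} {ω : Z ⟶ T.obj A₃}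
    {f : X ⟶ Y} {g : Y ⟶ Z} {h : A₁ ⟶ A₂} {k : A₂ ⟶ A₃}
    (θ : δ ≫ T.map h ⟶ f ≫ σ) (φ : σ ≫ T.map k ⟶ g ≫ ω) :
    δ ≫ T.map (h ≫ k) ⟶ (f ≫ g) ≫ ω :=
  δ ◁ (T.mapComp h k).hom ≫ (α_ _ _ _).inv ≫ θ ▷ T.map k ≫ (α_ _ _ _).hom ≫ f ◁ φ ≫ (α_ _ _ _).inv

/-- Pastings of generic cells between lax-generic 1-cells are generic cells. -/
def GenericCellsCompose : Prop :=
  ∀ (X Y Z : B) (A₁ A₂ A₃ : A) (δ : X ⟶ T.obj A₁) (σ : Y ⟶ T.obj A₂) (ω : Z ⟶ T.obj A₃)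
    (f : X ⟶ Y) (g : Y ⟶ Z) (h : A₁ ⟶ A₂) (k : A₂ ⟶ A₃)
    (θ : δ ≫ T.map h ⟶ f ≫ σ) (φ : σ ≫ T.map k ⟶ g ≫ ω),
    IsLaxGeneric T δ → IsLaxGeneric T σ → IsLaxGeneric T ω →
      IsGenericCell T θ → IsGenericCell T φ → IsGenericCell T (hpaste T θ φ)

end Main
end LaxFamilial

/-! Forward direction. Fix a universal lax cocone at each `X`. Fullness and faithfulness of the
comparison functors amount to universal factorizations of cells out of a leg, so the legs are
lax-generic, and essential surjectivity gives (a). Call a 2-cell between 1-cells `X ⟶ T C` cartesian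
(`Cocone.IsCart`) if a morphism `(u, ν)` of representations with `ν` invertible corresponds to it;
this does not depend on the representation chosen. The central fact is that a cell out of a
lax-generic 1-cell is generic if and only if it is cartesian (`IsGenericCell.isCart`,
`Cocone.IsCart.isGenericCell`). Cartesian 2-cells compose and are stable under whiskering by `T k`.
They are also stable under whiskering by 1-cells `f` of `B`, and this is where naturality in `X`
enters: every `η_ψ` is cartesian, and `f ◁ η_χ` agrees with some `η_ψ` up to invertible 2-cells. A
pasting of generic cells is built from these operations, which gives (b).

Backward direction. Let `M_X` have the lax-generic 1-cells out of `X` as objects, and as 1-cells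
over `f` take the connected components of the category of cells `δ ≫ T h ⟶ f ≫ σ`. Every component
contains a generic cell, and that cell is terminal in it. Components compose without (b), and
lax-generic factorizations supply cartesian lifts, so there is a pseudofunctor of fibres `M`. To
define `P`, choose a generic cell in each component. By (b) the pasting of two chosen cells is
generic, hence isomorphic to the chosen cell of the composite component; all coherence laws follow
from uniqueness of 2-cells into a generic cell (`CellHom.unique`). The chosen cells themselves form
`η`, and the universal factorizations say that its comparison functors are equivalences. -/

namespace LaxFamilial

/-! ### Calculus of extending and pasting cells. -/

section Pasting

variable {A : Type u₁} [Bicategory.{w₁, v₁} A] {B : Type u₂} [Bicategory.{w₂, v₂} B]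
  (T : A ⥤ᵖ B)

/-- The extension of a cell `γ : δ · T h ⟶ z` along a 1-cell `g`. -/
def extend {X : B} {A₁ A₂ C : A} {δ : X ⟶ T.obj A₁} {z : X ⟶ T.obj A₂} {h : A₁ ⟶ A₂}
    (γ : δ ≫ T.map h ⟶ z) (g : A₂ ⟶ C) : δ ≫ T.map (h ≫ g) ⟶ z ≫ T.map g :=
  δ ◁ (T.mapComp h g).hom ≫ (α_ _ _ _).inv ≫ γ ▷ T.map g

/-- The identity cell on `δ`. -/
def unitCell {X : B} {A₁ : A} (δ : X ⟶ T.obj A₁) : δ ≫ T.map (𝟙 A₁) ⟶ δ :=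
  δ ◁ (T.mapId A₁).hom ≫ (ρ_ δ).hom

variable {X : B} {A₁ A₂ A₃ A₄ : A} {δ : X ⟶ T.obj A₁} {z z' : X ⟶ T.obj A₂}
  {h : A₁ ⟶ A₂}

instance (δ : X ⟶ T.obj A₁) : IsIso (unitCell T δ) := by
  unfold unitCell; infer_instance

instance (γ : δ ≫ T.map h ⟶ z) [IsIso γ] (g : A₂ ⟶ A₃) : IsIso (extend T γ g) := by
  unfold extend; infer_instance

instance {f g : A₁ ⟶ A₂} (l : f ⟶ g) [IsIso l] : IsIso (T.map₂ l) := by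
  change IsIso ((T.mapFunctor A₁ A₂).map l)
  infer_instance

lemma whiskerLeft_map₂_comp {f g k : A₁ ⟶ A₂} (l : f ⟶ g) (m : g ⟶ k) :
    δ ◁ T.map₂ (l ≫ m) = δ ◁ T.map₂ l ≫ δ ◁ T.map₂ m := by
  rw [T.map₂_comp, whiskerLeft_comp]

lemma paste_eq {f : A₁ ⟶ A₃} {g : A₂ ⟶ A₃} (γ : δ ≫ T.map h ⟶ z) (ν : f ⟶ h ≫ g) :
    paste T γ ν = δ ◁ T.map₂ ν ≫ extend T γ g := rfl

lemma hpaste_eq {Y Z : B} {σ : Y ⟶ T.obj A₂} {ω : Z ⟶ T.obj A₃}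
    {f : X ⟶ Y} {g : Y ⟶ Z} {h : A₁ ⟶ A₂} {k : A₂ ⟶ A₃}
    (θ : δ ≫ T.map h ⟶ f ≫ σ) (φ : σ ≫ T.map k ⟶ g ≫ ω) :
    hpaste T θ φ = extend T θ k ≫ (α_ _ _ _).hom ≫ f ◁ φ ≫ (α_ _ _ _).inv := by
  simp [hpaste, extend]

lemma extend_comp (γ : δ ≫ T.map h ⟶ z) (j : z ⟶ z') (g : A₂ ⟶ A₃) :
    extend T (γ ≫ j) g = extend T γ g ≫ j ▷ T.map g := by
  simp [extend]

lemma extend_precomp {k : A₁ ⟶ A₂} (l : k ⟶ h) (γ : δ ≫ T.map h ⟶ z) (g : A₂ ⟶ A₃) :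
    extend T (δ ◁ T.map₂ l ≫ γ) g = δ ◁ T.map₂ (l ▷ g) ≫ extend T γ g := by
  simp [extend, T.map₂_whisker_right]

lemma extend_whisker (γ : δ ≫ T.map h ⟶ z) {g g' : A₂ ⟶ A₃} (κ : g ⟶ g') :
    extend T γ g ≫ z ◁ T.map₂ κ = δ ◁ T.map₂ (h ◁ κ) ≫ extend T γ g' := by
  have := whisker_exchange γ (T.map₂ κ)
  simp only [extend, T.map₂_whisker_left, whiskerLeft_comp, Category.assoc, whiskerLeft_inv_hom_assoc]
  rw [← this]
  simp

lemma extend_extend (γ : δ ≫ T.map h ⟶ z) (g : A₂ ⟶ A₃) (k : A₃ ⟶ A₄) :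
    extend T (extend T γ g) k =
      δ ◁ T.map₂ (α_ h g k).hom ≫ extend T γ (g ≫ k) ≫ z ◁ (T.mapComp g k).hom ≫
        (α_ _ _ _).inv := by
  have h4 := whisker_exchange γ (T.mapComp g k).hom
  simp only [extend, Category.assoc]
  rw [← reassoc_of% h4, T.map₂_associator]
  simp

lemma extend_unitCell (h : A₁ ⟶ A₂) :
    extend T (unitCell T δ) h = δ ◁ T.map₂ (λ_ h).hom := by
  rw [T.map₂_left_unitor]
  simp [extend, unitCell]

lemma extend_id (γ : δ ≫ T.map h ⟶ z) :
    extend T γ (𝟙 A₂) ≫ unitCell T z = δ ◁ T.map₂ (ρ_ h).hom ≫ γ := by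
  have h4 := whisker_exchange γ (T.mapId A₂).hom
  simp only [extend, unitCell, Category.assoc]
  rw [← reassoc_of% h4, T.map₂_right_unitor]
  simp

/-- Whiskering on the left by a 1-cell commutes with extension. -/
lemma extend_whiskerLeft {W : B} (f : W ⟶ X) (γ : δ ≫ T.map h ⟶ z) (g : A₂ ⟶ A₃) :
    extend T ((α_ f δ (T.map h)).hom ≫ f ◁ γ) g =
      (α_ _ _ _).hom ≫ f ◁ extend T γ g ≫ (α_ _ _ _).inv := by
  simp [extend]

end Pasting

/-! ### Generic cells and universal factorizations. -/

section Generic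

variable {A : Type u₁} [Bicategory.{w₁, v₁} A] {B : Type u₂} [Bicategory.{w₂, v₂} B]
  {T : A ⥤ᵖ B}
variable {X : B} {A₁ A₂ C : A} {δ : X ⟶ T.obj A₁} {z : X ⟶ T.obj A₂} {h k : A₁ ⟶ A₂}

/-- If `γ` factors through `φ` by `l`, then `φ` with `ν ≫ l ▷ g` is another factorization of `α`,
and universality returns a 2-cell `l'` backwards. That `l ≫ l'` is the identity follows from
subterminality. -/
lemma IsUniversalFactorization.isGenericCell {f : A₁ ⟶ C}
    {g : A₂ ⟶ C} {α : δ ≫ T.map f ⟶ z ≫ T.map g}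
    {γ : δ ≫ T.map h ⟶ z} {ν : f ⟶ h ≫ g} (H : IsUniversalFactorization T α γ ν) :
    IsGenericCell T γ where
  subterminal := H.subterminal
  retract k φ l hl := by
    obtain ⟨l', h1, -⟩ := H.lift k φ (ν ≫ l ▷ g) (by
      rw [← H.fac, ← hl, paste_eq, paste_eq, extend_precomp, whiskerLeft_map₂_comp,
        Category.assoc])
    refine ⟨l', h1, H.subterminal _ _ _ ?_⟩
    rw [whiskerLeft_map₂_comp, Category.assoc, h1, hl]
    simp

/-- A generic cell `γ` that factors through a generic cell `φ` does so by an isomorphism. -/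
lemma IsGenericCell.isIso {γ : δ ≫ T.map h ⟶ z} {φ : δ ≫ T.map k ⟶ z}
    (hγ : IsGenericCell T γ) (hφ : IsSubterminal T φ) (l : h ⟶ k)
    (hl : δ ◁ T.map₂ l ≫ φ = γ) : IsIso l := by
  obtain ⟨l', h1, h2⟩ := hγ.retract k φ l hl
  refine ⟨l', h2, hφ _ _ _ ?_⟩
  rw [whiskerLeft_map₂_comp, Category.assoc, hl, h1]
  simp

lemma IsGenericCell.of_iso {γ : δ ≫ T.map h ⟶ z} (hγ : IsGenericCell T γ) (l : k ⟶ h) [IsIso l] :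
    IsGenericCell T (δ ◁ T.map₂ l ≫ γ) where
  subterminal p ω τ e := by
    rw [← cancel_mono l]
    apply hγ.subterminal
    simpa only [whiskerLeft_map₂_comp, Category.assoc] using e
  retract p φ m hm := by
    obtain ⟨m', h1, h2⟩ := hγ.retract p φ (inv l ≫ m) (by
      rw [whiskerLeft_map₂_comp, Category.assoc, hm, ← Category.assoc, ← whiskerLeft_map₂_comp]
      simp)
    refine ⟨m' ≫ inv l, ?_, ?_⟩
    · rw [whiskerLeft_map₂_comp, Category.assoc, ← h1, ← Category.assoc (δ ◁ T.map₂ (inv l)),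
        ← whiskerLeft_map₂_comp]
      simp
    · have h3 : m ≫ m' = l := by simpa [IsIso.inv_comp_eq] using h2
      rw [reassoc_of% h3, IsIso.hom_inv_id]

/-- The universal factorization of a cell through a generic cell. -/
lemma IsLaxGeneric.exists_hull (hδ : IsLaxGeneric T δ) (φ : δ ≫ T.map k ⟶ z) :
    ∃ (h : A₁ ⟶ A₂) (γ : δ ≫ T.map h ⟶ z) (ν : k ⟶ h), IsGenericCell T γ ∧
      δ ◁ T.map₂ ν ≫ γ = φ ∧ (IsIso φ → IsIso γ ∧ IsIso ν) ∧
      ∀ (p : A₁ ⟶ A₂) (χ : δ ≫ T.map p ⟶ z) (ψ : k ⟶ p), δ ◁ T.map₂ ψ ≫ χ = φ →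
        ∃ ψ' : p ⟶ h, δ ◁ T.map₂ ψ' ≫ γ = χ ∧ ψ ≫ ψ' = ν := by
  -- Factor along an identity 1-cell; the unit cell of `z` absorbs the extra `T (𝟙 _)`.
  obtain ⟨h, γ, ν, H, H'⟩ := hδ A₂ A₂ z k (𝟙 _) (φ ≫ inv (unitCell T z))
  have key : ∀ (p : A₁ ⟶ A₂) (χ : δ ≫ T.map p ⟶ z) (ψ : k ⟶ p ≫ 𝟙 A₂),
      paste T χ ψ = (δ ◁ T.map₂ (ψ ≫ (ρ_ p).hom) ≫ χ) ≫ inv (unitCell T z) := by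
    intro p χ ψ
    rw [paste_eq, IsIso.eq_comp_inv, whiskerLeft_map₂_comp, Category.assoc, extend_id,
      Category.assoc]
  refine ⟨h, γ, ν ≫ (ρ_ h).hom, H.isGenericCell, ?_, fun i => ?_, fun p χ ψ e => ?_⟩
  · rw [← cancel_mono (inv (unitCell T z)), ← key, H.fac]
  · obtain ⟨i1, i2⟩ := H' inferInstance
    exact ⟨i1, inferInstance⟩
  · obtain ⟨ψ', h1, h2⟩ := H.lift p χ (ψ ≫ (ρ_ p).inv) (by rw [key]; simp [e])
    refine ⟨ψ', h1, ?_⟩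
    rw [← h2]
    simp

/-- By condition 3 of lax-genericity the comparison of an invertible cell with its generic hull is
invertible. -/
lemma IsLaxGeneric.isGenericCell_of_isIso (hδ : IsLaxGeneric T δ) (φ : δ ≫ T.map k ⟶ z)
    [IsIso φ] : IsGenericCell T φ := by
  obtain ⟨h, γ, ν, H, e, H', -⟩ := hδ.exists_hull φ
  obtain ⟨-, i⟩ := H' inferInstance
  rw [← e]
  exact H.of_iso ν

/-- A generic cell together with any 2-cell is the universal factorization of the pasting. -/
lemma IsGenericCell.isUniversalFactorization (hδ : IsLaxGeneric T δ) {γ : δ ≫ T.map h ⟶ z}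
    (hγ : IsGenericCell T γ) {f : A₁ ⟶ C} {g : A₂ ⟶ C} (ν : f ⟶ h ≫ g) :
    IsUniversalFactorization T (paste T γ ν) γ ν where
  fac := rfl
  subterminal := hγ.subterminal
  lift k φ ψ e := by
    -- Compare with the universal factorization that lax-genericity provides for the same pasting:
    -- the comparison `p : h ⟶ h₀` starts at a generic cell, so it is invertible and universality
    -- transfers.
    obtain ⟨h₀, γ₀, ν₀, H, -⟩ := hδ A₂ C z f g (paste T γ ν)
    obtain ⟨p, hp, hp'⟩ := H.lift h γ ν rfl
    obtain ⟨q, hq, hq'⟩ := H.lift k φ ψ e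
    have := hγ.isIso H.subterminal p hp
    refine ⟨q ≫ inv p, ?_, ?_⟩
    · rw [← hq, ← hp, whiskerLeft_map₂_comp, Category.assoc, ← Category.assoc (δ ◁ T.map₂ (inv p)),
        ← whiskerLeft_map₂_comp]
      simp
    · rw [comp_whiskerRight, ← Category.assoc, hq', ← hp', Category.assoc, ← comp_whiskerRight]
      simp

end Generic

/-! ### Invertible morphisms of representations. -/

section RepLemmas

variable {A : Type u₁} [Bicategory.{w₁, v₁} A] {N : Type u'} [Category.{v'} N]
  {Q : LocallyDiscrete N ⥤ᵖ A} {C : A}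

namespace Rep

lemma comp_cell {x y z : Rep Q C} (φ : x ⟶ y) (ψ : y ⟶ z) :
    (φ ≫ ψ).cell = φ.cell ≫ Q.map φ.idx ◁ ψ.cell ≫ (α_ _ _ _).inv ≫
      (Q.mapComp φ.idx ψ.idx).inv ▷ z.arr := rfl

lemma id_cell (x : Rep Q C) : Hom.cell (𝟙 x) = (λ_ x.arr).inv ≫ (Q.mapId x.idx).inv ▷ x.arr := rfl

/-- The morphism of representations with given components. -/
abbrev homMk {m n : LocallyDiscrete N} {x : Q.obj m ⟶ C} {y : Q.obj n ⟶ C} (u : m ⟶ n)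
    (ν : x ⟶ Q.map u ≫ y) : (⟨m, x⟩ : Rep Q C) ⟶ ⟨n, y⟩ :=
  Hom.mk (x := ⟨m, x⟩) (y := ⟨n, y⟩) u ν

lemma isIso_id_cell (x : Rep Q C) : IsIso (Hom.cell (𝟙 x)) := by
  rw [id_cell]; infer_instance

lemma isIso_cell_comp {x y z : Rep Q C} (φ : x ⟶ y) (ψ : y ⟶ z) [IsIso φ.cell] [IsIso ψ.cell] :
    IsIso (φ ≫ ψ).cell := by
  rw [comp_cell]; infer_instance

lemma exists_of_eq {x y : Rep Q C} {φ ψ : x ⟶ y} (h : φ = ψ) :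
    ∃ e : φ.idx ⟶ ψ.idx, IsIso e ∧ φ.cell ≫ Q.map₂ e ▷ y.arr = ψ.cell := by
  subst h
  exact ⟨𝟙 _, inferInstance, by simp⟩

instance {m n : LocallyDiscrete N} {u v : m ⟶ n} (e : u ⟶ v) [IsIso e] : IsIso (Q.map₂ e) := by
  change IsIso ((Q.mapFunctor m n).map e)
  infer_instance

/-- One inverse law makes `φ.cell` a monomorphism. The other only gives a section after whiskering
by `Q` of the inverse index; whiskering once more by `Q.map φ.idx` and using that the two 1-cells
compose to an identity up to isomorphism yields a section of `φ.cell` itself. -/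
lemma isIso_cell_of_isIso {x y : Rep Q C} (φ : x ⟶ y) [IsIso φ] : IsIso φ.cell := by
  obtain ⟨e, he, h1⟩ := exists_of_eq (IsIso.hom_inv_id φ)
  obtain ⟨e', he', h2⟩ := exists_of_eq (IsIso.inv_hom_id φ)
  rw [comp_cell, id_cell] at h1 h2
  simp only [Category.assoc] at h1 h2
  have hm : Mono φ.cell := by
    have : IsIso (φ.cell ≫ (Q.map φ.idx ◁ Hom.cell (inv φ) ≫ (α_ _ _ _).inv ≫
        (Q.mapComp φ.idx (Hom.idx (inv φ))).inv ▷ x.arr ≫ Q.map₂ e ▷ x.arr)) := by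
      rw [h1]; infer_instance
    exact mono_of_mono φ.cell (Q.map φ.idx ◁ Hom.cell (inv φ) ≫ (α_ _ _ _).inv ≫
        (Q.mapComp φ.idx (Hom.idx (inv φ))).inv ▷ x.arr ≫ Q.map₂ e ▷ x.arr)
  let r := (α_ (Q.map (Hom.idx (inv φ))) (Q.map φ.idx) y.arr).inv ≫
        (Q.mapComp (Hom.idx (inv φ)) φ.idx).inv ▷ y.arr ≫ Q.map₂ e' ▷ y.arr
  have hr : IsIso r := by dsimp only [r]; exact inferInstance
  let s := r ≫ inv ((λ_ y.arr).inv ≫ (Q.mapId y.idx).inv ▷ y.arr) ≫ Hom.cell (inv φ)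
  have hs : s ≫ Q.map (Hom.idx (inv φ)) ◁ φ.cell = 𝟙 _ := by
    rw [← cancel_mono r]
    simp only [s, Category.assoc]
    erw [h2]
    rw [IsIso.inv_hom_id]
    exact (Category.comp_id r).trans (Category.id_comp r).symm
  let E := asIso ((Q.mapComp φ.idx (Hom.idx (inv φ))).inv ≫ Q.map₂ e ≫ (Q.mapId x.idx).hom)
  have h3 : φ.cell = (λ_ _).inv ≫ E.inv ▷ _ ≫ (α_ _ _ _).hom ≫
      Q.map φ.idx ◁ Q.map (Hom.idx (inv φ)) ◁ φ.cell ≫ (α_ _ _ _).inv ≫ E.hom ▷ _ ≫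
        (λ_ _).hom := by
    have := whisker_exchange E.hom φ.cell
    simp only [comp_whiskerLeft, id_whiskerLeft, Category.assoc] at this
    rw [reassoc_of% this]
    simp
  have hsplit : IsSplitEpi φ.cell := IsSplitEpi.mk' ⟨(λ_ _).inv ≫ E.inv ▷ _ ≫ (α_ _ _ _).hom ≫
      Q.map φ.idx ◁ s ≫ (α_ _ _ _).inv ≫ E.hom ▷ _ ≫ (λ_ _).hom, by
    rw [h3]
    simp only [Category.assoc, Iso.hom_inv_id_assoc, hom_inv_whiskerRight_assoc,
      Iso.inv_hom_id_assoc]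
    rw [← whiskerLeft_comp_assoc, hs]
    simp⟩
  exact isIso_of_mono_of_isSplitEpi _

lemma isIso_idx_of_isIso {x y : Rep Q C} (φ : x ⟶ y) [IsIso φ] : IsIso φ.idx.as := by
  obtain ⟨e, -, -⟩ := exists_of_eq (IsIso.hom_inv_id φ)
  obtain ⟨e', -, -⟩ := exists_of_eq (IsIso.inv_hom_id φ)
  exact ⟨(Hom.idx (inv φ)).as, congrArg (·.as) (LocallyDiscrete.eq_of_hom e),
    congrArg (·.as) (LocallyDiscrete.eq_of_hom e')⟩

end Rep

end RepLemmas

/-! ### Cartesian 2-cells for a universal lax cocone. -/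

section CoconeLemmas

variable {A : Type u₁} [Bicategory.{w₁, v₁} A] {B : Type u₂} [Bicategory.{w₂, v₂} B]
  {T : A ⥤ᵖ B} {N : Type u'} [Category.{v'} N]
  {Q : LocallyDiscrete N ⥤ᵖ A} {X : B} (κ : Cocone T X Q)

/-- The 2-cells that correspond to a morphism of representations with invertible 2-cell. -/
def Cocone.IsCart {C : A} {a b : X ⟶ T.obj C} (β : a ⟶ b) : Prop :=
  ∃ (m n : LocallyDiscrete N) (x : Q.obj m ⟶ C) (y : Q.obj n ⟶ C) (i : a ≅ κ.app m ≫ T.map x)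
    (j : b ≅ κ.app n ≫ T.map y) (u : m ⟶ n) (ν : x ⟶ Q.map u ≫ y),
    IsIso ν ∧ β = i.hom ≫ paste T (κ.cell u) ν ≫ j.inv

variable [hκ : ∀ C, (κ.comparison C).IsEquivalence]

include hκ

lemma Cocone.exists_rep {C : A} (z : X ⟶ T.obj C) :
    ∃ (n : LocallyDiscrete N) (x : Q.obj n ⟶ C), Nonempty (κ.app n ≫ T.map x ≅ z) :=
  ⟨_, _, ⟨(κ.comparison C).objObjPreimageIso z⟩⟩

variable {m n : LocallyDiscrete N} {C : A} {x : Q.obj m ⟶ C} {y : Q.obj n ⟶ C}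

lemma Cocone.exists_paste_eq (β : κ.app m ≫ T.map x ⟶ κ.app n ≫ T.map y) :
    ∃ (u : m ⟶ n) (ν : x ⟶ Q.map u ≫ y), paste T (κ.cell u) ν = β := by
  obtain ⟨φ, hφ⟩ := (κ.comparison C).map_surjective
    (X := (⟨m, x⟩ : Rep Q C)) (Y := (⟨n, y⟩ : Rep Q C)) β
  exact ⟨φ.idx, φ.cell, hφ⟩

lemma Cocone.eq_of_paste_eq {u u' : m ⟶ n} {ν : x ⟶ Q.map u ≫ y} {ν' : x ⟶ Q.map u' ≫ y}
    (h : paste T (κ.cell u) ν = paste T (κ.cell u') ν') :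
    (⟨u, ν⟩ : Rep.Hom ⟨m, x⟩ ⟨n, y⟩) = ⟨u', ν'⟩ :=
  (κ.comparison C).map_injective (X := (⟨m, x⟩ : Rep Q C)) (Y := (⟨n, y⟩ : Rep Q C))
    (a₁ := ⟨u, ν⟩) (a₂ := ⟨u', ν'⟩) h

lemma Cocone.cell_eq_of_paste_eq {u : m ⟶ n} {ν ν' : x ⟶ Q.map u ≫ y}
    (h : paste T (κ.cell u) ν = paste T (κ.cell u) ν') : ν = ν' := by
  simpa using κ.eq_of_paste_eq h

lemma Cocone.isIso_of_isIso_paste {u : m ⟶ n} {ν : x ⟶ Q.map u ≫ y}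
    (h : IsIso (paste T (κ.cell u) ν)) : IsIso u.as ∧ IsIso ν := by
  have h1 : IsIso ((κ.comparison C).map (Rep.homMk u ν)) := h
  have := isIso_of_fully_faithful (κ.comparison C) (Rep.homMk u ν)
  exact ⟨Rep.isIso_idx_of_isIso (Rep.homMk u ν), Rep.isIso_cell_of_isIso (Rep.homMk u ν)⟩

/-- The legs of a universal lax cocone are lax-generic. -/
lemma Cocone.isLaxGeneric_app
    (hi : ∀ {m n : LocallyDiscrete N} (u : m ⟶ n), IsIso u.as → IsIso (κ.cell u))
    (m : LocallyDiscrete N) : IsLaxGeneric T (κ.app m) := by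
  intro A₂ C z f g α
  obtain ⟨n, x, ⟨j⟩⟩ := κ.exists_rep z
  -- `c` rewrites the target of `α` as a leg followed by `T` of a 1-cell, where the comparison
  -- functor can be applied.
  let c : z ≫ T.map g ⟶ κ.app n ≫ T.map (x ≫ g) :=
    j.inv ▷ T.map g ≫ (α_ _ _ _).hom ≫ κ.app n ◁ (T.mapComp x g).inv
  have hci : IsIso c := by dsimp only [c]; infer_instance
  have key : ∀ (u : m ⟶ n) (ψ : f ⟶ (Q.map u ≫ x) ≫ g),
      paste T (extend T (κ.cell u) x ≫ j.hom) ψ ≫ c =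
        paste T (κ.cell u) (ψ ≫ (α_ _ _ _).hom) := by
    intro u ψ
    rw [paste_eq, paste_eq, extend_comp, extend_extend, whiskerLeft_map₂_comp]
    simp [c]
  obtain ⟨u, ν, hν⟩ := κ.exists_paste_eq (α ≫ c)
  have fac : paste T (extend T (κ.cell u) x ≫ j.hom) (ν ≫ (α_ _ _ _).inv) = α := by
    rw [← cancel_mono c, key, ← hν]
    simp
  refine ⟨Q.map u ≫ x, extend T (κ.cell u) x ≫ j.hom, ν ≫ (α_ _ _ _).inv,
    ⟨fac, fun k ω τ e => ?_, fun k φ ψ e => ?_⟩, fun hα => ?_⟩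
  · rw [← Category.assoc, ← Category.assoc, cancel_mono] at e
    exact κ.cell_eq_of_paste_eq e
  -- Representing `φ` turns the competing factorization into a second preimage of `α ≫ c`.
  -- Faithfulness identifies it with `(u, ν)`, and `φ'` is then the required 2-cell.
  · obtain ⟨u', φ', hφ⟩ := κ.exists_paste_eq (φ ≫ j.inv)
    have hφ' : φ = κ.app m ◁ T.map₂ φ' ≫ extend T (κ.cell u') x ≫ j.hom := by
      rw [← cancel_mono j.inv, ← hφ, paste_eq]
      simp
    have h1 : paste T (κ.cell u') ((ψ ≫ φ' ▷ g) ≫ (α_ _ _ _).hom) = α ≫ c := by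
      rw [← key, ← e, hφ', paste_eq, paste_eq, extend_precomp, whiskerLeft_map₂_comp]
      simp
    have h2 := κ.eq_of_paste_eq (h1.trans hν.symm)
    obtain rfl : u' = u := congrArg Rep.Hom.idx h2
    obtain rfl := κ.cell_eq_of_paste_eq (h1.trans hν.symm)
    exact ⟨φ', hφ'.symm, by simp⟩
  -- An invertible `α` is represented by an isomorphism, so `u` and `ν` are both invertible; `hi`
  -- passes from `u` to `κ.cell u`.
  · obtain ⟨h2, h4⟩ := κ.isIso_of_isIso_paste (u := u) (ν := ν) (by rw [hν]; infer_instance)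
    have h3 := hi u h2
    exact ⟨inferInstance, inferInstance⟩

/-- The representing 2-cell of a cartesian 2-cell is invertible, whatever the representation. -/
lemma Cocone.IsCart.isIso {a b : X ⟶ T.obj C} {β : a ⟶ b} (h : κ.IsCart β)
    (i : a ≅ κ.app m ≫ T.map x) (j : b ≅ κ.app n ≫ T.map y) (u : m ⟶ n) (ν : x ⟶ Q.map u ≫ y)
    (e : β = i.hom ≫ paste T (κ.cell u) ν ≫ j.inv) : IsIso ν := by
  obtain ⟨m', n', x', y', i', j', u', ν', hν', e'⟩ := h
  -- Two representations of the same 1-cell are related by an isomorphism, whose 2-cell is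
  -- invertible. By faithfulness `(u, ν)` is `(u', ν')` composed with two such isomorphisms.
  obtain ⟨v, μ, hv⟩ := κ.exists_paste_eq (i.inv ≫ i'.hom)
  obtain ⟨w, ρ, hw⟩ := κ.exists_paste_eq (j'.inv ≫ j.hom)
  have h1 := (κ.isIso_of_isIso_paste (by rw [hv]; infer_instance)).2
  have h2 := (κ.isIso_of_isIso_paste (by rw [hw]; infer_instance)).2
  let φ : (⟨m, x⟩ : Rep Q C) ⟶ ⟨m', x'⟩ := ⟨v, μ⟩
  let χ : (⟨m', x'⟩ : Rep Q C) ⟶ ⟨n', y'⟩ := ⟨u', ν'⟩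
  let ψ : (⟨n', y'⟩ : Rep Q C) ⟶ ⟨n, y⟩ := ⟨w, ρ⟩
  have h3 : (κ.comparison C).map (φ ≫ χ ≫ ψ) = (κ.comparison C).map (⟨u, ν⟩ : (⟨m, x⟩ : Rep Q C) ⟶ ⟨n, y⟩) := by
    rw [Functor.map_comp, Functor.map_comp]
    change paste T (κ.cell v) μ ≫ paste T (κ.cell u') ν' ≫ paste T (κ.cell w) ρ =
      paste T (κ.cell u) ν
    rw [hv, hw, ← cancel_epi i.hom, ← cancel_mono j.inv]
    simp only [Category.assoc, ← e]
    simp [e']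
  have h4 := (κ.comparison C).map_injective h3
  have : IsIso (φ ≫ χ ≫ ψ).cell := by
    have : IsIso φ.cell := h1
    have : IsIso χ.cell := hν'
    have : IsIso ψ.cell := h2
    have := Rep.isIso_cell_comp χ ψ
    exact Rep.isIso_cell_comp φ (χ ≫ ψ)
  rw [h4] at this
  exact this

/-- The middle 1-cell `b` comes with two representations, so the isomorphism between them is
inserted before composing. -/
lemma Cocone.IsCart.comp {a b c : X ⟶ T.obj C} {β : a ⟶ b} {γ : b ⟶ c} (hβ : κ.IsCart β)
    (hγ : κ.IsCart γ) : κ.IsCart (β ≫ γ) := by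
  obtain ⟨m, n, x, y, i, j, u, ν, hν, e⟩ := hβ
  obtain ⟨m', n', x', y', i', j', u', ν', hν', e'⟩ := hγ
  obtain ⟨v, μ, hv⟩ := κ.exists_paste_eq (j.inv ≫ i'.hom)
  have h1 := (κ.isIso_of_isIso_paste (by rw [hv]; infer_instance)).2
  let φ : (⟨m, x⟩ : Rep Q C) ⟶ ⟨n, y⟩ := ⟨u, ν⟩
  let χ : (⟨n, y⟩ : Rep Q C) ⟶ ⟨m', x'⟩ := ⟨v, μ⟩
  let ψ : (⟨m', x'⟩ : Rep Q C) ⟶ ⟨n', y'⟩ := ⟨u', ν'⟩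
  refine ⟨m, n', x, y', i, j', (φ ≫ χ ≫ ψ).idx, (φ ≫ χ ≫ ψ).cell, ?_, ?_⟩
  · have : IsIso φ.cell := hν
    have : IsIso χ.cell := h1
    have : IsIso ψ.cell := hν'
    have := Rep.isIso_cell_comp χ ψ
    exact Rep.isIso_cell_comp φ (χ ≫ ψ)
  · have h3 : paste T (κ.cell (φ ≫ χ ≫ ψ).idx) (φ ≫ χ ≫ ψ).cell =
      paste T (κ.cell u) ν ≫ paste T (κ.cell v) μ ≫ paste T (κ.cell u') ν' := by
      change (κ.comparison C).map (φ ≫ χ ≫ ψ) = _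
      rw [Functor.map_comp, Functor.map_comp]
      rfl
    rw [h3, hv, e, e']
    simp

lemma Cocone.isCart_of_isIso {a b : X ⟶ T.obj C} (β : a ⟶ b) [IsIso β] : κ.IsCart β := by
  obtain ⟨n, x, ⟨j⟩⟩ := κ.exists_rep a
  let φ : (⟨n, x⟩ : Rep Q C) ⟶ ⟨n, x⟩ := 𝟙 _
  refine ⟨n, n, x, x, j.symm, (asIso β).symm ≪≫ j.symm, φ.idx, φ.cell, ?_, ?_⟩
  · exact Rep.isIso_id_cell _
  · have h3 : paste T (κ.cell φ.idx) φ.cell = 𝟙 _ := (κ.comparison C).map_id ⟨n, x⟩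
    rw [h3]
    simp

omit hκ in
-- Represent the target leg by the identity 1-cell; the representing 2-cell is then the inverse of a
-- right unitor.
lemma Cocone.isCart_cell (u : m ⟶ n) : κ.IsCart (κ.cell u) :=
  ⟨m, n, Q.map u, 𝟙 _, Iso.refl _, (asIso (unitCell T _)).symm, u, (ρ_ _).inv, inferInstance, by
    rw [paste_eq]
    simp only [Iso.refl_hom, Iso.symm_inv, asIso_hom, Category.assoc, Category.id_comp, extend_id]
    rw [← Category.assoc, ← whiskerLeft_map₂_comp]
    simp⟩

omit hκ in
lemma Cocone.IsCart.whiskerRight {C' : A} {a b : X ⟶ T.obj C} {β : a ⟶ b} (h : κ.IsCart β)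
    (k : C ⟶ C') : κ.IsCart (β ▷ T.map k) := by
  obtain ⟨m, n, x, y, i, j, u, ν, hν, e⟩ := h
  refine ⟨m, n, x ≫ k, y ≫ k,
    whiskerRightIso i (T.map k) ≪≫ α_ _ _ _ ≪≫ whiskerLeftIso _ (T.mapComp x k).symm,
    whiskerRightIso j (T.map k) ≪≫ α_ _ _ _ ≪≫ whiskerLeftIso _ (T.mapComp y k).symm,
    u, ν ▷ k ≫ (α_ _ _ _).hom, inferInstance, ?_⟩
  have h1 := extend_extend T (κ.cell u) y k
  have h2 := extend_precomp T ν (extend T (κ.cell u) y) k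
  rw [h1] at h2
  have h3 : paste T (κ.cell u) (ν ▷ k ≫ (α_ _ _ _).hom) =
      extend T (paste T (κ.cell u) ν) k ≫ (α_ _ _ _).hom ≫ κ.app n ◁ (T.mapComp y k).inv := by
    rw [paste_eq, paste_eq, h2, whiskerLeft_map₂_comp]
    simp
  rw [h3, e]
  simp [extend]

end CoconeLemmas

/-! ### Naturality in `X`: cartesian 2-cells are stable under whiskering by 1-cells of `B`. -/

section FibreCart

variable {A : Type u₁} [Bicategory.{w₁, v₁} A] {B : Type u₂} [Bicategory.{w₂, v₂} B]
  {T : A ⥤ᵖ B} {M : Bᵒᵖ ⥤ᵖ Cat.{v', u'}} {P : El M ⥤ᵖ A}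
  (η : Lax.LaxTrans (El.proj M).toLax (P.comp T).toLax)

/-- The cartesian 1-cell of `∫ M` over `f`. -/
def El.cartHom {X : B} (y : El M) (f : X ⟶ y.base) :
    (⟨X, (pull M f).obj y.fiber⟩ : El M) ⟶ y :=
  ⟨f, 𝟙 _⟩

lemma map_id_comp {C : Type*} [Category* C] {D : Type*} [Category* D] (F : C ⥤ D) {a : C} {b : D}
    (f : F.obj a ⟶ b) : F.map (𝟙 a) ≫ f = f := by
  simp

/-- Every 1-cell of `∫ M` is a vertical one followed by a cartesian one. -/
def El.factorIso {x y : El M} (ψ : x ⟶ y) :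
    (El.inclMap M ψ.fiber : (⟨x.base, x.fiber⟩ : El M) ⟶ ⟨x.base, _⟩) ≫ El.cartHom y ψ.base ≅ ψ :=
  El.isoMk (λ_ ψ.base) (by
    have h := El.pull₂_leftUnitor ψ.base y.fiber (M := M)
    simp only [El.comp_fiber, El.inclMap, El.cartHom, Category.assoc]
    exact (congrArg (fun t => ψ.fiber ≫ (pullId M x.base).inv.app _ ≫ t)
      (map_id_comp (pull M (𝟙 x.base)) _)).trans ((congrArg (ψ.fiber ≫ ·) h).trans
        (Category.comp_id _)))

/-- The 2-cell of `η` at a vertical 1-cell. -/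
def vertCell {X : B} {m n : M.obj (op X)} (φ : (⟨X, m⟩ : El M) ⟶ ⟨X, n⟩) (b : φ.base ⟶ 𝟙 X) :
    leg η ⟨X, m⟩ ≫ T.map (P.map φ) ⟶ leg η ⟨X, n⟩ :=
  natCell η φ ≫ b ▷ leg η ⟨X, n⟩ ≫ (λ_ _).hom

lemma fibreCocone_cell {X : B} {m n : LocallyDiscrete (M.obj (op X))} (u : m ⟶ n) :
    (fibreCocone η X).cell u = vertCell η ((El.incl M X).map u) (El.inclBase M u).hom := rfl

/-- Lax functoriality of `η` on a composite, solved for the composite. The grouping isolates the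
whiskered `natCell η φ`; the outer factors are invertible as soon as `natCell η χ` is. -/
lemma natCell_eq_of_iso {X : B} {m n : M.obj (op X)} {y : El M} (φ : (⟨X, m⟩ : El M) ⟶ ⟨X, n⟩)
    (χ : (⟨X, n⟩ : El M) ⟶ y) (ψ : (⟨X, m⟩ : El M) ⟶ y) (e : φ ≫ χ ≅ ψ) :
    natCell η ψ = (inv (leg η ⟨X, m⟩ ◁ T.map₂ (P.map₂ e.hom)) ≫
      inv (leg η ⟨X, m⟩ ◁ T.map₂ (P.mapComp φ χ).inv) ≫
      leg η ⟨X, m⟩ ◁ (T.mapComp (P.map φ) (P.map χ)).hom ≫ (α_ _ _ _).inv) ≫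
      natCell η φ ▷ T.map (P.map χ) ≫
      ((α_ _ _ _).hom ≫ φ.base ◁ natCell η χ ≫ (α_ φ.base χ.base (leg η y)).inv ≫
        e.hom.base ▷ leg η y) := by
  have h1 := natCell_naturality η e.hom
  have h2 := natCell_comp η φ χ
  simp only [Category.assoc]
  rw [IsIso.eq_inv_comp, IsIso.eq_inv_comp, ← h1]
  have h3 := congrArg (· ≫ e.hom.base ▷ leg η y) h2
  simp only [Category.assoc] at h3 ⊢
  exact h3

/-- The same law solved for its last factor. For `φ` a cartesian lift of `f` it expresses `f ◁ η_χ`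
through `η` at a single 1-cell out of the fibre over `X`. -/
lemma whiskerLeft_natCell {X : B} {w : M.obj (op X)} {y z : El M} (φ : (⟨X, w⟩ : El M) ⟶ y)
    (χ : y ⟶ z) [IsIso (natCell η φ)] :
    φ.base ◁ natCell η χ = (inv (leg η _ ◁ (T.mapComp (P.map φ) (P.map χ)).hom ≫
        (α_ _ _ _).inv ≫ natCell η φ ▷ T.map (P.map χ) ≫ (α_ _ _ _).hom) ≫
          leg η _ ◁ T.map₂ (P.mapComp φ χ).inv) ≫ natCell η (φ ≫ χ) ≫
          (α_ φ.base χ.base (leg η z)).hom := by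
  have h2 := natCell_comp η φ χ
  rw [Category.assoc, IsIso.eq_inv_comp]
  have h3 := congrArg (· ≫ (α_ φ.base χ.base (leg η z)).hom) h2
  simp only [Category.assoc, Iso.inv_hom_id, Category.comp_id] at h3 ⊢
  exact h3.symm

variable (hc : ∀ (x y : El M) (φ : x ⟶ y), IsIso φ.fiber → IsIso (η.naturality φ))

include hc

lemma isIso_natCell {x y : El M} (φ : x ⟶ y) (h : IsIso φ.fiber) : IsIso (natCell η φ) := hc x y φ h

lemma isIso_vertCell {X : B} {m n : M.obj (op X)} (φ : (⟨X, m⟩ : El M) ⟶ ⟨X, n⟩)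
    (b : φ.base ≅ 𝟙 X) (h : IsIso φ.fiber) : IsIso (vertCell η φ b.hom) := by
  have := isIso_natCell η hc φ h
  unfold vertCell
  infer_instance

lemma isIso_fibreCocone_cell {X : B} {m n : LocallyDiscrete (M.obj (op X))} (u : m ⟶ n)
    (hu : IsIso u.as) : IsIso ((fibreCocone η X).cell u) := by
  rw [fibreCocone_cell]
  refine isIso_vertCell η hc (m := m.as) (n := n.as) _ (El.inclBase M u) ?_
  change IsIso (u.as ≫ (pullId M X).inv.app n.as)
  infer_instance

variable [∀ X C, ((fibreCocone η X).comparison C).IsEquivalence]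

omit hc in
lemma isCart_natCell_of_vertCell {X : B} {m n : M.obj (op X)} (φ : (⟨X, m⟩ : El M) ⟶ ⟨X, n⟩)
    (b : φ.base ≅ 𝟙 X) (h : (fibreCocone η X).IsCart (vertCell η φ b.hom)) :
    (fibreCocone η X).IsCart (natCell η φ) := by
  have h' : natCell η φ =
      vertCell η φ b.hom ≫ (λ_ (leg η ⟨X, n⟩)).inv ≫ b.inv ▷ leg η ⟨X, n⟩ := by
    simp [vertCell]
  rw [h']
  exact h.comp _ (Cocone.isCart_of_isIso _ ((λ_ (leg η ⟨X, n⟩)).inv ≫ b.inv ▷ leg η ⟨X, n⟩))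

/-- Factor `ψ` as vertical followed by cartesian: `η` at the vertical part is a cell of the cocone
up to an isomorphism, and at the cartesian part it is invertible. -/
lemma isCart_natCell {x y : El M} (ψ : x ⟶ y) :
    (fibreCocone η x.base).IsCart (natCell η ψ) := by
  obtain ⟨X, m⟩ := x
  have : IsIso (natCell η (El.cartHom y ψ.base)) := isIso_natCell η hc _ (by
    dsimp only [El.cartHom]; infer_instance)
  have h3 : (fibreCocone η X).IsCart (natCell η (El.inclMap M ψ.fiber)) := by
    exact isCart_natCell_of_vertCell η (El.inclMap M ψ.fiber) (Iso.refl (𝟙 X))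
      ((fibreCocone η X).isCart_cell (Quiver.Hom.toLoc ψ.fiber))
  have h4 := h3.whiskerRight _ (P.map (El.cartHom y ψ.base))
  have : IsIso (El.factorIso ψ).hom.base := inferInstanceAs (IsIso (λ_ ψ.base).hom)
  rw [natCell_eq_of_iso η _ _ _ (El.factorIso ψ)]
  exact (Cocone.isCart_of_isIso _ _).comp _ (h4.comp _ (Cocone.isCart_of_isIso _ _))

lemma isCart_whiskerLeft_base_natCell {X : B} {w : M.obj (op X)} {y z : El M}
    (φ : (⟨X, w⟩ : El M) ⟶ y) (χ : y ⟶ z) (h : IsIso (natCell η φ)) :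
    (fibreCocone η X).IsCart (φ.base ◁ natCell η χ) := by
  rw [whiskerLeft_natCell η φ χ]
  exact (Cocone.isCart_of_isIso _ _).comp _
    ((isCart_natCell η hc (φ ≫ χ)).comp _ (Cocone.isCart_of_isIso _ _))

lemma isCart_whiskerLeft_natCell {X : B} {y z : El M} (f : X ⟶ y.base) (χ : y ⟶ z) :
    (fibreCocone η X).IsCart (f ◁ natCell η χ) :=
  isCart_whiskerLeft_base_natCell η hc (El.cartHom y f) χ (isIso_natCell η hc _ (by
    dsimp only [El.cartHom]; infer_instance))

lemma isCart_whiskerLeft_vertCell {X Y : B} (f : X ⟶ Y) {m n : M.obj (op Y)}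
    (φ : (⟨Y, m⟩ : El M) ⟶ ⟨Y, n⟩) (b : φ.base ≅ 𝟙 Y) :
    (fibreCocone η X).IsCart (f ◁ vertCell η φ b.hom) := by
  rw [vertCell, whiskerLeft_comp]
  exact (isCart_whiskerLeft_natCell η hc f φ).comp _
    (Cocone.isCart_of_isIso _ (f ◁ (b.hom ▷ leg η ⟨Y, n⟩ ≫ (λ_ (leg η ⟨Y, n⟩)).hom)))

/-- Whiskering with a 1-cell `f : X ⟶ Y` preserves cartesian 2-cells. -/
lemma Cocone.IsCart.whiskerLeft {X Y : B} (f : X ⟶ Y) {C : A} {a b : Y ⟶ T.obj C} {β : a ⟶ b}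
    (h : (fibreCocone η Y).IsCart β) : (fibreCocone η X).IsCart (f ◁ β) := by
  obtain ⟨m, n, x, y, i, j, u, ν, hν, e⟩ := h
  have hcell : (fibreCocone η X).IsCart (f ◁ (fibreCocone η Y).cell u) := by
    exact isCart_whiskerLeft_vertCell η hc f (m := m.as) (n := n.as)
      ((El.incl M Y).map u) (El.inclBase M u)
  have h1 : f ◁ β = (f ◁ i.hom ≫ f ◁ (fibreCocone η Y).app m ◁ T.map₂ ν ≫
      f ◁ (fibreCocone η Y).app m ◁ (T.mapComp _ y).hom ≫ f ◁ (α_ _ _ _).inv ≫ (α_ _ _ _).inv) ≫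
      (f ◁ (fibreCocone η Y).cell u) ▷ T.map y ≫ ((α_ _ _ _).hom ≫ f ◁ j.inv) := by
    rw [e, paste]
    simp
  rw [h1]
  exact (Cocone.isCart_of_isIso _ _).comp _
    ((hcell.whiskerRight _ y).comp _ (Cocone.isCart_of_isIso _ _))

end FibreCart

/-! ### Generic cells are exactly the cartesian cells out of lax-generic 1-cells. -/

section GenericCart

variable {A : Type u₁} [Bicategory.{w₁, v₁} A] {B : Type u₂} [Bicategory.{w₂, v₂} B]
  {T : A ⥤ᵖ B} {N : Type u'} [Category.{v'} N]
  {Q : LocallyDiscrete N ⥤ᵖ A} {X : B} (κ : Cocone T X Q)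

/-- Whiskering by a 1-cell `x` with `x' ≫ x ≅ 𝟙` loses nothing: `ω` is recovered from `x ◁ ω`, so `x
◁ -` is faithful and reflects isomorphisms. -/
lemma whiskerLeft_retract {a b c : A} {x : a ⟶ b} {x' : b ⟶ a} (ν : 𝟙 b ⟶ x' ≫ x) [IsIso ν]
    {f g : b ⟶ c} (ω : f ⟶ g) :
    ω = (λ_ f).inv ≫ ν ▷ f ≫ (α_ _ _ _).hom ≫ x' ◁ x ◁ ω ≫ (α_ _ _ _).inv ≫ inv ν ▷ g ≫
      (λ_ g).hom := by
  have := whisker_exchange ν ω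
  simp only [comp_whiskerLeft, id_whiskerLeft, Category.assoc] at this
  simp only [← inv_whiskerRight]
  rw [← reassoc_of% this]
  simp

variable [hκ : ∀ C, (κ.comparison C).IsEquivalence]

include hκ

/-- A lax-generic 1-cell is a leg of the universal cocone, up to an equivalence. -/
lemma IsLaxGeneric.exists_leg {A₁ : A} {δ : X ⟶ T.obj A₁} (hδ : IsLaxGeneric T δ) :
    ∃ (m : LocallyDiscrete N) (x : Q.obj m ⟶ A₁) (e : κ.app m ≫ T.map x ≅ δ)
      (x' : A₁ ⟶ Q.obj m) (e' : δ ≫ T.map x' ⟶ κ.app m) (ν : 𝟙 A₁ ⟶ x' ≫ x),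
      IsIso e' ∧ IsIso ν ∧ paste T e' ν ≫ e.hom = unitCell T δ := by
  obtain ⟨m, x, ⟨e⟩⟩ := κ.exists_rep δ
  -- The isomorphism from `δ` to `κ.app m ≫ T.map x` is itself a cell that lax-genericity of `δ`
  -- factors; this produces `x'` in the opposite direction, and condition 3 makes `e'` and `ν`
  -- invertible.
  obtain ⟨x', e', ν, H, H'⟩ := hδ _ _ (κ.app m) (𝟙 _) x (unitCell T δ ≫ e.inv)
  obtain ⟨h1, h2⟩ := H' inferInstance
  exact ⟨m, x, e, x', e', ν, h1, h2, by simp [H.fac]⟩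

/-- Transported to a leg, pasting `ω` with `γ` is represented by `x ◁ ω ≫ μ` with `μ` invertible.
Faithfulness of the comparison recovers `x ◁ ω`, hence `ω`. -/
lemma Cocone.IsCart.isSubterminal {A₁ A₂ : A} {δ : X ⟶ T.obj A₁} (hδ : IsLaxGeneric T δ)
    {z : X ⟶ T.obj A₂} {h : A₁ ⟶ A₂} {γ : δ ≫ T.map h ⟶ z} (hγ : κ.IsCart γ) :
    IsSubterminal T γ := by
  obtain ⟨m, x, e, x', e', ν, he', hν, -⟩ := hδ.exists_leg κ
  obtain ⟨n, y, ⟨j⟩⟩ := κ.exists_rep z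
  obtain ⟨u, μ, hμ⟩ := κ.exists_paste_eq (extend T e.hom h ≫ γ ≫ j.inv)
  have := hγ.isIso κ (asIso (extend T e.hom h)).symm j.symm u μ (by simp [hμ])
  intro k ω τ hωτ
  have key : ∀ ω : k ⟶ h, paste T (κ.cell u) (x ◁ ω ≫ μ) =
      extend T e.hom k ≫ (δ ◁ T.map₂ ω ≫ γ) ≫ j.inv := by
    intro ω
    rw [paste_eq, whiskerLeft_map₂_comp, Category.assoc, ← paste_eq, hμ, Category.assoc,
      ← Category.assoc, ← Category.assoc (extend T e.hom k), extend_whisker]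
  have h0 : paste T (κ.cell u) (x ◁ ω ≫ μ) = paste T (κ.cell u) (x ◁ τ ≫ μ) := by
    rw [key, key, hωτ]
  have h1 := κ.cell_eq_of_paste_eq h0
  rw [cancel_mono] at h1
  rw [whiskerLeft_retract ν ω, h1, ← whiskerLeft_retract ν τ]

/-- A representation `(u, μ)` of `γ` makes `γ` factor by some `l` through a cartesian cell `φ` built
from `κ.cell u`. Since `γ` is generic and `φ` is subterminal, `l` is invertible. -/
lemma IsGenericCell.isCart {A₁ A₂ : A} {δ : X ⟶ T.obj A₁} (hδ : IsLaxGeneric T δ)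
    {z : X ⟶ T.obj A₂} {h : A₁ ⟶ A₂} {γ : δ ≫ T.map h ⟶ z} (hγ : IsGenericCell T γ) :
    κ.IsCart γ := by
  obtain ⟨m, x, e, x', e', ν, he', hν, hu⟩ := hδ.exists_leg κ
  obtain ⟨n, y, ⟨j⟩⟩ := κ.exists_rep z
  obtain ⟨u, μ, hμ⟩ := κ.exists_paste_eq (extend T e.hom h ≫ γ ≫ j.inv)
  let φ : δ ≫ T.map (x' ≫ Q.map u ≫ y) ⟶ z :=
    extend T e' (Q.map u ≫ y) ≫ extend T (κ.cell u) y ≫ j.hom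
  have hφ : κ.IsCart φ := by
    have : φ = (extend T e' (Q.map u ≫ y) ≫ κ.app m ◁ (T.mapComp _ y).hom ≫ (α_ _ _ _).inv) ≫
        κ.cell u ▷ T.map y ≫ j.hom := by
      simp only [φ, Category.assoc]
      simp [extend]
    rw [this]
    exact (κ.isCart_of_isIso _).comp _
      (((κ.isCart_cell u).whiskerRight _ y).comp _ (κ.isCart_of_isIso _))
  let l : h ⟶ x' ≫ Q.map u ≫ y := (λ_ h).inv ≫ ν ▷ h ≫ (α_ _ _ _).hom ≫ x' ◁ μ
  have hl : δ ◁ T.map₂ l ≫ φ = γ := by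
    have h1 := extend_whisker T e' μ
    have h2 : κ.app m ◁ T.map₂ μ ≫ extend T (κ.cell u) y ≫ j.hom = extend T e.hom h ≫ γ := by
      rw [← Category.assoc, ← paste_eq, hμ]
      simp
    have h3 := extend_precomp T ν (extend T e' x ≫ e.hom) h
    rw [← Category.assoc, ← paste_eq, hu, extend_unitCell, extend_comp, extend_extend] at h3
    have h4 : δ ◁ T.map₂ (λ_ h).inv ≫ δ ◁ T.map₂ (λ_ h).hom = 𝟙 _ := by
      rw [← whiskerLeft_map₂_comp]
      simp
    simp only [l, φ, whiskerLeft_map₂_comp, Category.assoc]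
    rw [← reassoc_of% h1, h2]
    rw [h3] at h4
    simp only [Category.assoc] at h4
    change _ ≫ _ ≫ _ ≫ extend T e' (x ≫ h) ≫ extend T e.hom h ≫ γ = γ
    rw [extend.eq_1 T e.hom h]
    simp only [Category.assoc]
    rw [reassoc_of% h4]
  have := hγ.isIso (hφ.isSubterminal κ hδ) l hl
  rw [← hl]
  exact (κ.isCart_of_isIso _).comp _ hφ

/-- The generic hull `φ` of `γ` is cartesian, so both cells have invertible representing 2-cells;
these differ by `x ◁ l`. Hence `l` is invertible and `γ` is isomorphic to its hull. -/
lemma Cocone.IsCart.isGenericCell {A₁ A₂ : A} {δ : X ⟶ T.obj A₁} (hδ : IsLaxGeneric T δ)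
    {z : X ⟶ T.obj A₂} {h : A₁ ⟶ A₂} {γ : δ ≫ T.map h ⟶ z} (hγ : κ.IsCart γ) :
    IsGenericCell T γ := by
  obtain ⟨k, φ, l, hφ, hl, -⟩ := hδ.exists_hull γ
  obtain ⟨m, x, e, x', e', ν, he', hν, -⟩ := hδ.exists_leg κ
  obtain ⟨n, y, ⟨j⟩⟩ := κ.exists_rep z
  obtain ⟨u, μ, hμ⟩ := κ.exists_paste_eq (extend T e.hom k ≫ φ ≫ j.inv)
  have h1 := (hφ.isCart κ hδ).isIso κ (asIso (extend T e.hom k)).symm j.symm u μ (by simp [hμ])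
  have h2 := hγ.isIso κ (asIso (extend T e.hom h)).symm j.symm u (x ◁ l ≫ μ) (by
    have h3 : paste T (κ.cell u) (x ◁ l ≫ μ) = extend T e.hom h ≫ (δ ◁ T.map₂ l ≫ φ) ≫ j.inv := by
      rw [paste_eq, whiskerLeft_map₂_comp, Category.assoc, ← paste_eq, hμ, Category.assoc,
        ← Category.assoc, ← Category.assoc (extend T e.hom h), extend_whisker]
    simp [h3, hl])
  have h3 : IsIso (x ◁ l) := IsIso.of_isIso_comp_right _ μ
  have h4 : IsIso l := by
    rw [whiskerLeft_retract ν l]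
    infer_instance
  rw [← hl]
  exact hφ.of_iso l

end GenericCart

/-! ### Lax familial functors satisfy (a) and (b). -/

section Forward

variable {A : Type u₁} [Bicategory.{w₁, v₁} A] {B : Type u₂} [Bicategory.{w₂, v₂} B]
  {T : A ⥤ᵖ B}

lemma IsLaxFamilial.admitsLaxGenericFactorizations
    (h : IsLaxFamilial.{w₁, w₂, v₁, v₂, u₁, u₂, v', u'} T) : AdmitsLaxGenericFactorizations T := by
  obtain ⟨M, P, η, hc, he⟩ := h
  intro X C y
  obtain ⟨m, x, ⟨e⟩⟩ := (fibreCocone η X).exists_rep y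
  exact ⟨_, _, x, (fibreCocone η X).isLaxGeneric_app (isIso_fibreCocone_cell η hc) m, ⟨e⟩⟩

lemma IsLaxFamilial.genericCellsCompose
    (h : IsLaxFamilial.{w₁, w₂, v₁, v₂, u₁, u₂, v', u'} T) : GenericCellsCompose T := by
  obtain ⟨M, P, η, hc, he⟩ := h
  intro X Y Z A₁ A₂ A₃ δ σ ω f g h k θ φ hδ hσ hω hθ hφ
  have h1 := (hθ.isCart (fibreCocone η X) hδ).whiskerRight _ k
  have h2 := (hφ.isCart (fibreCocone η Y) hσ).whiskerLeft η hc f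
  refine Cocone.IsCart.isGenericCell (fibreCocone η X) hδ ?_
  have h3 : hpaste T θ φ = (δ ◁ (T.mapComp h k).hom ≫ (α_ _ _ _).inv) ≫ θ ▷ T.map k ≫
      (α_ _ _ _).hom ≫ f ◁ φ ≫ (α_ _ _ _).inv := by
    simp [hpaste]
  rw [h3]
  exact (Cocone.isCart_of_isIso _ _).comp _ (h1.comp _ ((Cocone.isCart_of_isIso _ _).comp _
    (h2.comp _ (Cocone.isCart_of_isIso _ _))))

end Forward

/-! ### From displayed data with cartesian lifts to a pseudofunctor of fibres. -/

set_option linter.checkUnivs false in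
/-- A bicategory over `B` with discrete hom-categories of vertical 2-cells, together with a choice
of cartesian 1-cells: the data from which a pseudofunctor `Bᵒᵖ ⥤ᵖ Cat` is built. -/
structure Displayed (B : Type u₂) [Bicategory.{w₂, v₂} B] where
  /-- The objects over an object of `B`. -/
  Ob : B → Type u'
  /-- The 1-cells over a 1-cell of `B`. -/
  Hom {X Y : B} (f : X ⟶ Y) (x : Ob X) (y : Ob Y) : Type v'
  /-- The action of the 2-cells of `B`. -/
  act {X Y : B} {f g : X ⟶ Y} (ν : f ⟶ g) {x : Ob X} {y : Ob Y} : Hom f x y → Hom g x y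
  /-- The identity 1-cells. -/
  id {X : B} (x : Ob X) : Hom (𝟙 X) x x
  /-- The composition of 1-cells. -/
  comp {X Y Z : B} {f : X ⟶ Y} {g : Y ⟶ Z} {x : Ob X} {y : Ob Y} {z : Ob Z} :
    Hom f x y → Hom g y z → Hom (f ≫ g) x z
  act_id {X Y : B} {f : X ⟶ Y} {x : Ob X} {y : Ob Y} (u : Hom f x y) : act (𝟙 f) u = u
  act_act {X Y : B} {f g h : X ⟶ Y} (μ : f ⟶ g) (ν : g ⟶ h) {x : Ob X} {y : Ob Y}
    (u : Hom f x y) : act ν (act μ u) = act (μ ≫ ν) u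
  comp_act_left {X Y Z : B} {f f' : X ⟶ Y} (ν : f ⟶ f') {g : Y ⟶ Z} {x : Ob X} {y : Ob Y}
    {z : Ob Z} (u : Hom f x y) (v : Hom g y z) : comp (act ν u) v = act (ν ▷ g) (comp u v)
  comp_act_right {X Y Z : B} {f : X ⟶ Y} {g g' : Y ⟶ Z} (ν : g ⟶ g') {x : Ob X} {y : Ob Y}
    {z : Ob Z} (u : Hom f x y) (v : Hom g y z) : comp u (act ν v) = act (f ◁ ν) (comp u v)
  assoc {X Y Z W : B} {f : X ⟶ Y} {g : Y ⟶ Z} {h : Z ⟶ W} {x : Ob X} {y : Ob Y} {z : Ob Z}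
    {w : Ob W} (u : Hom f x y) (v : Hom g y z) (t : Hom h z w) :
    act (α_ f g h).hom (comp (comp u v) t) = comp u (comp v t)
  id_comp {X Y : B} {f : X ⟶ Y} {x : Ob X} {y : Ob Y} (u : Hom f x y) :
    act (λ_ f).hom (comp (id x) u) = u
  comp_id {X Y : B} {f : X ⟶ Y} {x : Ob X} {y : Ob Y} (u : Hom f x y) :
    act (ρ_ f).hom (comp u (id y)) = u
  /-- The reindexing of an object. -/
  pull {X Y : B} (f : X ⟶ Y) (y : Ob Y) : Ob X
  /-- The cartesian 1-cell. -/
  cart {X Y : B} (f : X ⟶ Y) (y : Ob Y) : Hom f (pull f y) y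
  existsUnique_lift {W X Y : B} (e : W ⟶ X) (f : X ⟶ Y) {x : Ob W} {y : Ob Y}
    (u : Hom (e ≫ f) x y) : ∃! v : Hom e x (pull f y), comp v (cart f y) = u

namespace Displayed

variable {B : Type u₂} [Bicategory.{w₂, v₂} B] (D : Displayed.{w₂, v₂, u₂, v', u'} B)

/-- Composition with a vertical 1-cell on the left. -/
def vcomp {X Y : B} {f : X ⟶ Y} {x x' : D.Ob X} {y : D.Ob Y} (v : D.Hom (𝟙 X) x x')
    (u : D.Hom f x' y) : D.Hom f x y :=
  D.act (λ_ f).hom (D.comp v u)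

/-- Composition with a vertical 1-cell on the right. -/
def rcomp {X Y : B} {f : X ⟶ Y} {x : D.Ob X} {y y' : D.Ob Y} (u : D.Hom f x y)
    (v : D.Hom (𝟙 Y) y y') : D.Hom f x y' :=
  D.act (ρ_ f).hom (D.comp u v)

variable {D}

lemma comp_assoc' {X Y Z W : B} {f : X ⟶ Y} {g : Y ⟶ Z} {h : Z ⟶ W} {x : D.Ob X} {y : D.Ob Y}
    {z : D.Ob Z} {w : D.Ob W} (u : D.Hom f x y) (v : D.Hom g y z) (t : D.Hom h z w) :
    D.comp (D.comp u v) t = D.act (α_ f g h).inv (D.comp u (D.comp v t)) := by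
  rw [← D.assoc, D.act_act, Iso.hom_inv_id, D.act_id]

section

variable {X Y Z : B} {f f' : X ⟶ Y} {g : Y ⟶ Z} {x x' x'' : D.Ob X} {y y' y'' : D.Ob Y}
  {z : D.Ob Z}

lemma act_vcomp (ν : f ⟶ f') (v : D.Hom (𝟙 X) x x') (u : D.Hom f x' y) :
    D.act ν (D.vcomp v u) = D.vcomp v (D.act ν u) := by
  rw [vcomp, vcomp, D.comp_act_right, D.act_act, D.act_act]
  simp

lemma act_rcomp (ν : f ⟶ f') (u : D.Hom f x y) (v : D.Hom (𝟙 Y) y y') :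
    D.act ν (D.rcomp u v) = D.rcomp (D.act ν u) v := by
  rw [rcomp, rcomp, D.comp_act_left, D.act_act, D.act_act]
  simp

lemma vcomp_comp (v : D.Hom (𝟙 X) x x') (u : D.Hom f x' y) (w : D.Hom g y z) :
    D.comp (D.vcomp v u) w = D.vcomp v (D.comp u w) := by
  rw [vcomp, vcomp, D.comp_act_left, comp_assoc', D.act_act]
  simp

lemma vcomp_vcomp (v : D.Hom (𝟙 X) x x') (w : D.Hom (𝟙 X) x' x'') (u : D.Hom f x'' y) :
    D.vcomp (D.vcomp v w) u = D.vcomp v (D.vcomp w u) := by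
  conv_lhs => rw [vcomp, vcomp_comp, act_vcomp, ← vcomp]

lemma comp_vcomp (u : D.Hom f x y) (v : D.Hom (𝟙 Y) y y') (w : D.Hom g y' z) :
    D.comp u (D.vcomp v w) = D.comp (D.rcomp u v) w := by
  rw [vcomp, rcomp, D.comp_act_left, D.comp_act_right, comp_assoc', D.act_act]
  simp

lemma vcomp_rcomp (v : D.Hom (𝟙 X) x x') (u : D.Hom f x' y) (w : D.Hom (𝟙 Y) y y') :
    D.rcomp (D.vcomp v u) w = D.vcomp v (D.rcomp u w) := by
  rw [rcomp, vcomp_comp, act_vcomp, ← rcomp]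

lemma rcomp_eq_vcomp (v : D.Hom (𝟙 X) x x') (w : D.Hom (𝟙 X) x' x'') :
    D.rcomp v w = D.vcomp v w := by
  rw [rcomp, vcomp, unitors_equal]

lemma rcomp_vcomp (u : D.Hom f x y) (v : D.Hom (𝟙 Y) y y') (w : D.Hom (𝟙 Y) y' y'') :
    D.rcomp u (D.vcomp v w) = D.rcomp (D.rcomp u v) w := by
  rw [rcomp, comp_vcomp, ← rcomp]

lemma id_vcomp (u : D.Hom f x y) : D.vcomp (D.id x) u = u := D.id_comp u

lemma rcomp_id (u : D.Hom f x y) : D.rcomp u (D.id y) = u := D.comp_id u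

lemma vcomp_id (v : D.Hom (𝟙 X) x x') : D.vcomp v (D.id x') = v := by
  rw [← rcomp_eq_vcomp, rcomp_id]

variable (D) in
lemma comp_cart_injective {W : B} {e : W ⟶ X} {w : D.Ob W} {v v' : D.Hom e w (D.pull f y)}
    (h : D.comp v (D.cart f y) = D.comp v' (D.cart f y)) : v = v' :=
  (D.existsUnique_lift e f _).unique h rfl

/-- The tool for all pseudofunctor laws of the fibres: equality of vertical 1-cells into a reindexed
object is tested after composing with the cartesian 1-cell. -/
lemma vcomp_cart_injective {v v' : D.Hom (𝟙 X) x (D.pull f y)}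
    (h : D.vcomp v (D.cart f y) = D.vcomp v' (D.cart f y)) : v = v' := by
  apply D.comp_cart_injective
  have := congrArg (D.act (λ_ f).inv) h
  simpa [vcomp, D.act_act, D.act_id] using this

/-- The lift of a 1-cell along a cartesian 1-cell. -/
noncomputable def lift {W : B} {e : W ⟶ X} {w : D.Ob W} (u : D.Hom (e ≫ f) w y) :
    D.Hom e w (D.pull f y) :=
  (D.existsUnique_lift e f u).choose

lemma lift_comp_cart {W : B} {e : W ⟶ X} {w : D.Ob W} (u : D.Hom (e ≫ f) w y) :
    D.comp (lift u) (D.cart f y) = u :=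
  (D.existsUnique_lift e f u).choose_spec.1

/-- The vertical factorization of a 1-cell through a cartesian 1-cell. -/
noncomputable def vlift (u : D.Hom f x y) : D.Hom (𝟙 X) x (D.pull f y) :=
  lift (D.act (λ_ f).inv u)

lemma vlift_vcomp_cart (u : D.Hom f x y) : D.vcomp (vlift u) (D.cart f y) = u := by
  rw [vcomp, vlift, lift_comp_cart, D.act_act, Iso.inv_hom_id, D.act_id]

end

variable (D)

/-- The fibre category over `X`. -/
instance fibCategory (X : B) : Category.{v'} (D.Ob X) where
  Hom x y := D.Hom (𝟙 X) x y
  id x := D.id x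
  comp u v := D.vcomp u v
  id_comp u := id_vcomp u
  comp_id u := vcomp_id u
  assoc u v w := vcomp_vcomp u v w

variable {D}

section

variable {X Y Z W : B}

/-- Reindexing of vertical 1-cells. -/
noncomputable def pullMap (f : X ⟶ Y) {y y' : D.Ob Y} (v : D.Hom (𝟙 Y) y y') :
    D.Hom (𝟙 X) (D.pull f y) (D.pull f y') :=
  vlift (D.rcomp (D.cart f y) v)

/-- The action of the 2-cells on reindexed objects. -/
noncomputable def pullAct {f g : X ⟶ Y} (ν : f ⟶ g) (y : D.Ob Y) :
    D.Hom (𝟙 X) (D.pull f y) (D.pull g y) :=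
  vlift (D.act ν (D.cart f y))

/-- Reindexing along a composite, compared with iterated reindexing. -/
noncomputable def pullSplit (f : X ⟶ Y) (g : Y ⟶ Z) (z : D.Ob Z) :
    D.Hom (𝟙 X) (D.pull (f ≫ g) z) (D.pull f (D.pull g z)) :=
  vlift (lift (D.cart (f ≫ g) z))

/-- Iterated reindexing, compared with reindexing along a composite. -/
noncomputable def pullMerge (f : X ⟶ Y) (g : Y ⟶ Z) (z : D.Ob Z) :
    D.Hom (𝟙 X) (D.pull f (D.pull g z)) (D.pull (f ≫ g) z) :=
  vlift (D.comp (D.cart f (D.pull g z)) (D.cart g z))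

lemma pullMap_vcomp (f : X ⟶ Y) {y y' : D.Ob Y} (v : D.Hom (𝟙 Y) y y') :
    D.vcomp (pullMap f v) (D.cart f y') = D.rcomp (D.cart f y) v :=
  vlift_vcomp_cart _

lemma pullAct_vcomp {f g : X ⟶ Y} (ν : f ⟶ g) (y : D.Ob Y) :
    D.vcomp (pullAct ν y) (D.cart g y) = D.act ν (D.cart f y) :=
  vlift_vcomp_cart _

lemma pullMerge_vcomp (f : X ⟶ Y) (g : Y ⟶ Z) (z : D.Ob Z) :
    D.vcomp (pullMerge f g z) (D.cart (f ≫ g) z) = D.comp (D.cart f (D.pull g z)) (D.cart g z) :=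
  vlift_vcomp_cart _

lemma pullSplit_vcomp (f : X ⟶ Y) (g : Y ⟶ Z) (z : D.Ob Z) :
    D.vcomp (pullSplit f g z) (D.comp (D.cart f (D.pull g z)) (D.cart g z)) = D.cart (f ≫ g) z := by
  rw [← vcomp_comp, pullSplit, vlift_vcomp_cart, lift_comp_cart]

lemma pullMap_id (f : X ⟶ Y) (y : D.Ob Y) : pullMap f (D.id y) = D.id (D.pull f y) :=
  vcomp_cart_injective (by rw [pullMap_vcomp, rcomp_id, id_vcomp])

lemma pullMap_comp (f : X ⟶ Y) {y y' y'' : D.Ob Y} (u : D.Hom (𝟙 Y) y y')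
    (v : D.Hom (𝟙 Y) y' y'') :
    pullMap f (D.vcomp u v) = D.vcomp (pullMap f u) (pullMap f v) :=
  vcomp_cart_injective (by
    rw [pullMap_vcomp, vcomp_vcomp, pullMap_vcomp, ← vcomp_rcomp, pullMap_vcomp, rcomp_vcomp])

lemma pullAct_naturality {f g : X ⟶ Y} (ν : f ⟶ g) {y y' : D.Ob Y} (v : D.Hom (𝟙 Y) y y') :
    D.vcomp (pullMap f v) (pullAct ν y') = D.vcomp (pullAct ν y) (pullMap g v) :=
  vcomp_cart_injective (by
    rw [vcomp_vcomp, vcomp_vcomp, pullAct_vcomp, pullMap_vcomp, ← act_vcomp, pullMap_vcomp,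
      ← vcomp_rcomp, pullAct_vcomp, act_rcomp])

lemma pullAct_id (f : X ⟶ Y) (y : D.Ob Y) : pullAct (𝟙 f) y = D.id (D.pull f y) :=
  vcomp_cart_injective (by rw [pullAct_vcomp, D.act_id, id_vcomp])

lemma pullAct_comp {f g h : X ⟶ Y} (μ : f ⟶ g) (ν : g ⟶ h) (y : D.Ob Y) :
    pullAct (μ ≫ ν) y = D.vcomp (pullAct μ y) (pullAct ν y) :=
  vcomp_cart_injective (by
    rw [vcomp_vcomp, pullAct_vcomp, pullAct_vcomp, ← act_vcomp, pullAct_vcomp, D.act_act])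

/-- A cartesian 1-cell over an identity is already vertical, so it can serve as the unit constraint;
its inverse is the lift of the identity. -/
lemma cart_vcomp_vlift_id (y : D.Ob X) :
    D.vcomp (D.cart (𝟙 X) y) (vlift (D.id y)) = D.id (D.pull (𝟙 X) y) :=
  vcomp_cart_injective (by rw [vcomp_vcomp, vlift_vcomp_cart, vcomp_id, id_vcomp])

lemma split_vcomp_merge (f : X ⟶ Y) (g : Y ⟶ Z) (z : D.Ob Z) :
    D.vcomp (pullSplit f g z) (pullMerge f g z) = D.id _ :=
  vcomp_cart_injective (by rw [vcomp_vcomp, pullMerge_vcomp, pullSplit_vcomp, id_vcomp])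

/-- The target is an iterated reindexing, so the test against cartesian 1-cells is made twice. -/
lemma merge_vcomp_split (f : X ⟶ Y) (g : Y ⟶ Z) (z : D.Ob Z) :
    D.vcomp (pullMerge f g z) (pullSplit f g z) = D.id _ :=
  vcomp_cart_injective (D.comp_cart_injective (by
    rw [vcomp_vcomp, vcomp_comp, vcomp_comp, pullSplit_vcomp, pullMerge_vcomp, id_vcomp]))

lemma pullMerge_naturality (f : X ⟶ Y) (g : Y ⟶ Z) {z z' : D.Ob Z} (v : D.Hom (𝟙 Z) z z') :
    D.vcomp (pullMap f (pullMap g v)) (pullMerge f g z') =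
      D.vcomp (pullMerge f g z) (pullMap (f ≫ g) v) :=
  vcomp_cart_injective (by
    rw [vcomp_vcomp, vcomp_vcomp, pullMerge_vcomp, pullMap_vcomp, ← vcomp_comp, pullMap_vcomp,
      ← vcomp_rcomp, pullMerge_vcomp, ← comp_vcomp, pullMap_vcomp, rcomp, rcomp, D.comp_act_right,
      comp_assoc', D.act_act]
    simp)

lemma pullSplit_naturality (f : X ⟶ Y) (g : Y ⟶ Z) {z z' : D.Ob Z} (v : D.Hom (𝟙 Z) z z') :
    D.vcomp (pullMap (f ≫ g) v) (pullSplit f g z') =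
      D.vcomp (pullSplit f g z) (pullMap f (pullMap g v)) := by
  have h := congrArg (fun t => D.vcomp (pullSplit f g z) (D.vcomp t (pullSplit f g z')))
    (pullMerge_naturality f g v)
  rw [vcomp_vcomp, merge_vcomp_split, vcomp_id, vcomp_vcomp, ← vcomp_vcomp (pullSplit f g z),
    split_vcomp_merge, id_vcomp] at h
  exact h.symm

lemma pullAct_whiskerRight {f g : X ⟶ Y} (ν : f ⟶ g) (h : Y ⟶ Z) (z : D.Ob Z) :
    pullAct (ν ▷ h) z =
      D.vcomp (pullSplit f h z) (D.vcomp (pullAct ν (D.pull h z)) (pullMerge g h z)) :=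
  vcomp_cart_injective (by
    rw [vcomp_vcomp, vcomp_vcomp, pullMerge_vcomp, pullAct_vcomp, ← vcomp_comp, pullAct_vcomp,
      D.comp_act_left, ← act_vcomp, pullSplit_vcomp])

lemma pullAct_whiskerLeft (f : X ⟶ Y) {g h : Y ⟶ Z} (ν : g ⟶ h) (z : D.Ob Z) :
    pullAct (f ◁ ν) z =
      D.vcomp (pullSplit f g z) (D.vcomp (pullMap f (pullAct ν z)) (pullMerge f h z)) :=
  vcomp_cart_injective (by
    rw [vcomp_vcomp, vcomp_vcomp, pullMerge_vcomp, pullAct_vcomp, ← vcomp_comp, pullMap_vcomp,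
      ← comp_vcomp, pullAct_vcomp, D.comp_act_right, ← act_vcomp, pullSplit_vcomp])

lemma pullAct_associator (f : X ⟶ Y) (g : Y ⟶ Z) (h : Z ⟶ W) (w : D.Ob W) :
    pullAct (α_ f g h).inv w =
      D.vcomp (pullSplit f (g ≫ h) w) (D.vcomp (pullMap f (pullSplit g h w))
        (D.vcomp (D.id _) (D.vcomp (pullMerge f g (D.pull h w)) (pullMerge (f ≫ g) h w)))) :=
  vcomp_cart_injective (by
    rw [id_vcomp, vcomp_vcomp, vcomp_vcomp, vcomp_vcomp, pullMerge_vcomp, pullAct_vcomp,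
      ← vcomp_comp (pullMerge f g _), pullMerge_vcomp, comp_assoc', ← act_vcomp, ← act_vcomp,
      ← vcomp_comp, pullMap_vcomp, ← comp_vcomp, pullSplit_vcomp, pullSplit_vcomp])

lemma pullAct_rightUnitor (f : X ⟶ Y) (y : D.Ob Y) :
    pullAct (ρ_ f).hom y =
      D.vcomp (pullSplit f (𝟙 Y) y) (D.vcomp (pullMap f (D.cart (𝟙 Y) y)) (D.id _)) :=
  vcomp_cart_injective (by
    rw [vcomp_id, vcomp_vcomp, pullAct_vcomp, pullMap_vcomp, rcomp, ← act_vcomp, pullSplit_vcomp])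

lemma pullAct_leftUnitor (f : X ⟶ Y) (y : D.Ob Y) :
    pullAct (λ_ f).hom y =
      D.vcomp (pullSplit (𝟙 X) f y) (D.vcomp (D.cart (𝟙 X) (D.pull f y)) (D.id _)) :=
  vcomp_cart_injective (by
    rw [vcomp_id, vcomp_vcomp, pullAct_vcomp, vcomp.eq_1 D (D.cart (𝟙 X) (D.pull f y)), ← act_vcomp,
      pullSplit_vcomp])

end

variable (D)

/-- The reindexing functor. -/
noncomputable def pullFunctor {X Y : B} (f : X ⟶ Y) : D.Ob Y ⥤ D.Ob X where
  obj y := D.pull f y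
  map v := pullMap f v
  map_id y := pullMap_id f y
  map_comp u v := pullMap_comp f u v

/-- The action of the 2-cells on the reindexing functors. -/
noncomputable def pullTrans {X Y : B} {f g : X ⟶ Y} (ν : f ⟶ g) :
    D.pullFunctor f ⟶ D.pullFunctor g where
  app y := pullAct ν y
  naturality _ _ v := pullAct_naturality ν v

/-- The unit constraint of reindexing. -/
noncomputable def pullIdIso (X : B) : D.pullFunctor (𝟙 X) ≅ 𝟭 (D.Ob X) :=
  NatIso.ofComponents
    (fun y => ⟨D.cart (𝟙 X) y, vlift (D.id y), cart_vcomp_vlift_id y, vlift_vcomp_cart _⟩)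
    (fun v => (pullMap_vcomp (𝟙 X) v).trans (rcomp_eq_vcomp _ _))

/-- The composition constraint of reindexing. -/
noncomputable def pullCompIso {X Y Z : B} (f : X ⟶ Y) (g : Y ⟶ Z) :
    D.pullFunctor (f ≫ g) ≅ D.pullFunctor g ⋙ D.pullFunctor f :=
  NatIso.ofComponents
    (fun z => ⟨pullSplit f g z, pullMerge f g z, split_vcomp_merge f g z, merge_vcomp_split f g z⟩)
    (fun v => pullSplit_naturality f g v)

/-- The pseudofunctor of fibres. -/
noncomputable def fibres : Bᵒᵖ ⥤ᵖ Cat.{v', u'} where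
  obj X := Cat.of (D.Ob X.unop)
  map f := (D.pullFunctor f.unop).toCatHom
  map₂ ν := (D.pullTrans ν.unop2).toCatHom₂
  map₂_id f := Cat.Hom₂.ext (NatTrans.ext (funext fun y => pullAct_id f.unop y))
  map₂_comp μ ν := Cat.Hom₂.ext (NatTrans.ext (funext fun y => pullAct_comp μ.unop2 ν.unop2 y))
  mapId X := Cat.Hom.isoMk (D.pullIdIso X.unop)
  mapComp f g := Cat.Hom.isoMk (D.pullCompIso g.unop f.unop)
  -- Composition is reversed in `Bᵒᵖ`: left and right whiskering and the two unitors change places,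
  -- and the associator is inverted.
  map₂_whisker_left f _ _ ν := Cat.Hom₂.ext (NatTrans.ext (funext fun y =>
    pullAct_whiskerRight ν.unop2 f.unop y))
  map₂_whisker_right ν h := Cat.Hom₂.ext (NatTrans.ext (funext fun y =>
    pullAct_whiskerLeft h.unop ν.unop2 y))
  map₂_associator f g h := Cat.Hom₂.ext (NatTrans.ext (funext fun y =>
    pullAct_associator h.unop g.unop f.unop y))
  map₂_left_unitor f := Cat.Hom₂.ext (NatTrans.ext (funext fun y =>
    pullAct_rightUnitor f.unop y))
  map₂_right_unitor f := Cat.Hom₂.ext (NatTrans.ext (funext fun y =>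
    pullAct_leftUnitor f.unop y))

variable {D}

/-- The object of `D` over `x.base` given by an object of the Grothendieck construction. -/
def ob (x : El D.fibres) : D.Ob x.base := x.fiber

/-- The vertical part of a 1-cell of the Grothendieck construction. -/
def vert {x y : El D.fibres} (φ : x ⟶ y) : D.Hom (𝟙 x.base) (ob x) (D.pull φ.base (ob y)) :=
  φ.fiber

/-- The 1-cell of `D` that corresponds to a 1-cell of the Grothendieck construction. -/
def tot {x y : El D.fibres} (φ : x ⟶ y) : D.Hom φ.base (ob x) (ob y) :=
  D.vcomp (vert φ) (D.cart φ.base (ob y))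

lemma vert_comp {x y z : El D.fibres} (φ : x ⟶ y) (ψ : y ⟶ z) :
    vert (φ ≫ ψ) = D.vcomp (vert φ) (D.vcomp (pullMap φ.base (vert ψ))
      (pullMerge φ.base ψ.base (ob z))) := rfl

lemma vert_eq {x y : El D.fibres} {φ ψ : x ⟶ y} (σ : φ ⟶ ψ) :
    D.vcomp (vert φ) (pullAct σ.base (ob y)) = vert ψ := σ.w

lemma tot_id (x : El D.fibres) : tot (𝟙 x) = D.id (ob x) :=
  vlift_vcomp_cart _

lemma tot_comp {x y z : El D.fibres} (φ : x ⟶ y) (ψ : y ⟶ z) :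
    tot (φ ≫ ψ) = D.comp (tot φ) (tot ψ) := by
  have h : D.vcomp (vert (φ ≫ ψ)) (D.cart (φ.base ≫ ψ.base) (ob z)) =
      D.comp (tot φ) (tot ψ) := by
    rw [vert_comp, vcomp_vcomp, vcomp_vcomp, pullMerge_vcomp, ← vcomp_comp (pullMap _ _),
      pullMap_vcomp, ← comp_vcomp, ← vcomp_comp]
    rfl
  exact h

lemma act_tot {x y : El D.fibres} {φ ψ : x ⟶ y} (σ : φ ⟶ ψ) :
    D.act σ.base (tot φ) = tot ψ := by
  rw [tot, tot, act_vcomp, ← pullAct_vcomp, ← vcomp_vcomp, vert_eq]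

lemma vcomp_vlift_id_vcomp {X : B} {x x' : D.Ob X} (u : D.Hom (𝟙 X) x x') :
    D.vcomp (D.vcomp u (vlift (D.id x'))) (D.cart (𝟙 X) x') = u := by
  rw [vcomp_vcomp, vlift_vcomp_cart, vcomp_id]

lemma tot_inclMap {X : B} {m n : D.fibres.obj (op X)} (u : m ⟶ n) :
    tot (El.inclMap D.fibres u) = (u : D.Hom (𝟙 X) (ob ⟨X, m⟩) (ob ⟨X, n⟩)) :=
  vcomp_vlift_id_vcomp _

end Displayed

/-! ### Morphisms of cells over 2-cells of `B`. -/

section HPaste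

variable {A : Type u₁} [Bicategory.{w₁, v₁} A] {B : Type u₂} [Bicategory.{w₂, v₂} B]
  (T : A ⥤ᵖ B) {W X Y Z : B} {A₀ A₁ A₂ A₃ : A}
  {δ : W ⟶ T.obj A₀} {σ : X ⟶ T.obj A₁} {ω : Y ⟶ T.obj A₂} {τ : Z ⟶ T.obj A₃}

/-- The 2-cell `l : h ⟶ k` is a morphism from `γ` to `φ` over the 2-cell `ν : f ⟶ g`. -/
def CellHom {f g : W ⟶ X} {h k : A₀ ⟶ A₁} (ν : f ⟶ g) (l : h ⟶ k) (γ : δ ≫ T.map h ⟶ f ≫ σ)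
    (φ : δ ≫ T.map k ⟶ g ≫ σ) : Prop :=
  δ ◁ T.map₂ l ≫ φ = γ ≫ ν ▷ σ

variable {T}

namespace CellHom

variable {f f' f'' : W ⟶ X} {h h' h'' : A₀ ⟶ A₁} {ν : f ⟶ f'} {ν' : f' ⟶ f''} {l : h ⟶ h'}
  {l' : h' ⟶ h''} {γ : δ ≫ T.map h ⟶ f ≫ σ} {γ' : δ ≫ T.map h' ⟶ f' ≫ σ}
  {γ'' : δ ≫ T.map h'' ⟶ f'' ≫ σ}
  {g g' : X ⟶ Y} {k k' : A₁ ⟶ A₂} {μ : g ⟶ g'} {m : k ⟶ k'} {φ : σ ≫ T.map k ⟶ g ≫ ω}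
  {φ' : σ ≫ T.map k' ⟶ g' ≫ ω}

lemma refl (γ : δ ≫ T.map h ⟶ f ≫ σ) : CellHom T (𝟙 f) (𝟙 h) γ γ := by
  simp [CellHom]

lemma mk_comp (ν : f ⟶ f') (γ : δ ≫ T.map h ⟶ f ≫ σ) : CellHom T ν (𝟙 h) γ (γ ≫ ν ▷ σ) := by
  simp [CellHom]

lemma comp (H : CellHom T ν l γ γ') (H' : CellHom T ν' l' γ' γ'') :
    CellHom T (ν ≫ ν') (l ≫ l') γ γ'' := by
  unfold CellHom at *
  rw [whiskerLeft_map₂_comp, Category.assoc, H', ← Category.assoc, H]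
  simp

lemma trans {ν'' : f ⟶ f''} (H : CellHom T ν l γ γ') (H' : CellHom T ν' l' γ' γ'')
    (e : ν ≫ ν' = ν'') : CellHom T ν'' (l ≫ l') γ γ'' := e ▸ H.comp H'

/-- The source of all coherence below: parallel 2-cells over the same `ν` into a generic cell
coincide. -/
lemma unique {l₁ l₂ : h ⟶ h'} (hγ : IsGenericCell T γ') (H : CellHom T ν l₁ γ γ')
    (H' : CellHom T ν l₂ γ γ') : l₁ = l₂ :=
  hγ.subterminal _ _ _ (Eq.trans H (Eq.symm H'))

lemma symm {ν : f ≅ f'} {l : h ≅ h'} (H : CellHom T ν.hom l.hom γ γ') :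
    CellHom T ν.inv l.inv γ' γ := by
  unfold CellHom at *
  rw [← cancel_mono (ν.hom ▷ σ), Category.assoc, ← H, ← Category.assoc, ← whiskerLeft_map₂_comp]
  simp

lemma hpaste_left (H : CellHom T ν l γ γ') (φ : σ ≫ T.map k ⟶ g ≫ ω) :
    CellHom T (ν ▷ g) (l ▷ k) (hpaste T γ φ) (hpaste T γ' φ) := by
  unfold CellHom at *
  rw [hpaste_eq, hpaste_eq, ← Category.assoc, ← extend_precomp, H, extend_comp]
  have := whisker_exchange ν φ
  simp only [whiskerRight_comp, Category.assoc] at this ⊢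
  rw [← cancel_mono (α_ f' g ω).hom]
  simp only [Category.assoc, Iso.inv_hom_id, Category.comp_id, this, Iso.hom_inv_id_assoc]

lemma hpaste_right (γ : δ ≫ T.map h ⟶ f ≫ σ) (H : CellHom T μ m φ φ') :
    CellHom T (f ◁ μ) (h ◁ m) (hpaste T γ φ) (hpaste T γ φ') := by
  unfold CellHom at *
  rw [hpaste_eq, hpaste_eq, ← Category.assoc, ← extend_whisker]
  simp only [comp_whiskerLeft, Category.assoc, Iso.inv_hom_id_assoc]
  rw [← whiskerLeft_comp_assoc, H]
  simp

lemma hpaste_assoc {g : X ⟶ Y} {e : Y ⟶ Z} {p : A₂ ⟶ A₃} (γ : δ ≫ T.map h ⟶ f ≫ σ)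
    (φ : σ ≫ T.map k ⟶ g ≫ ω) (χ : ω ≫ T.map p ⟶ e ≫ τ) :
    CellHom T (α_ f g e).hom (α_ h k p).hom (hpaste T (hpaste T γ φ) χ)
      (hpaste T γ (hpaste T φ χ)) := by
  unfold CellHom
  have h1 := extend_whiskerLeft T f φ p
  have h2 := extend_extend T γ k p
  simp only [hpaste_eq, extend_comp, Category.assoc] at *
  rw [h2]
  simp only [extend, Category.assoc]
  simp

lemma hpaste_unit_left (φ : σ ≫ T.map k ⟶ g ≫ ω) :
    CellHom T (λ_ g).hom (λ_ k).hom (hpaste T (unitCell T σ ≫ (λ_ σ).inv) φ) φ := by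
  unfold CellHom
  rw [hpaste_eq, extend_comp, extend_unitCell]
  simp

lemma hpaste_unit_right (γ : δ ≫ T.map h ⟶ f ≫ σ) :
    CellHom T (ρ_ f).hom (ρ_ h).hom (hpaste T γ (unitCell T σ ≫ (λ_ σ).inv)) γ := by
  unfold CellHom
  rw [← extend_id, hpaste_eq]
  simp [unitCell]

end CellHom

end HPaste

/-! ### Connected components of cells, and their generic representatives. -/

section Components

variable {A : Type u₁} [Bicategory.{w₁, v₁} A] {B : Type u₂} [Bicategory.{w₂, v₂} B]
  {T : A ⥤ᵖ B} {X : B} {A₁ A₂ : A}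

/-- The cells out of `δ` into `z`. -/
structure Cell (δ : X ⟶ T.obj A₁) (z : X ⟶ T.obj A₂) where
  /-- The underlying 1-cell. -/
  arr : A₁ ⟶ A₂
  /-- The underlying 2-cell. -/
  cell : δ ≫ T.map arr ⟶ z

/-- There is a morphism between two cells. -/
def Cell.Le {δ : X ⟶ T.obj A₁} {z : X ⟶ T.obj A₂} (a b : Cell δ z) : Prop :=
  ∃ l : a.arr ⟶ b.arr, δ ◁ T.map₂ l ≫ b.cell = a.cell

/-- The connected components of the category of cells out of `δ` into `z`. -/
def Components (δ : X ⟶ T.obj A₁) (z : X ⟶ T.obj A₂) : Type max v₁ w₂ :=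
  Quot (Cell.Le (δ := δ) (z := z))

namespace Components

variable {δ : X ⟶ T.obj A₁} {z : X ⟶ T.obj A₂} {h k : A₁ ⟶ A₂}

/-- The component of a cell. -/
def mk (γ : δ ≫ T.map h ⟶ z) : Components δ z := Quot.mk _ ⟨h, γ⟩

lemma mk_eq {γ : δ ≫ T.map h ⟶ z} {φ : δ ≫ T.map k ⟶ z} (l : h ⟶ k)
    (e : δ ◁ T.map₂ l ≫ φ = γ) : mk γ = mk φ :=
  Quot.sound ⟨l, e⟩

lemma exists_rep (u : Components δ z) : ∃ (h : A₁ ⟶ A₂) (γ : δ ≫ T.map h ⟶ z), mk γ = u := by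
  obtain ⟨⟨h, γ⟩, rfl⟩ := Quot.exists_rep u
  exact ⟨h, γ, rfl⟩

lemma exists_isGenericCell (hδ : IsLaxGeneric T δ) (u : Components δ z) :
    ∃ (h : A₁ ⟶ A₂) (γ : δ ≫ T.map h ⟶ z), IsGenericCell T γ ∧ mk γ = u := by
  obtain ⟨h, γ, rfl⟩ := u.exists_rep
  obtain ⟨k, φ, l, hφ, e, -⟩ := hδ.exists_hull γ
  exact ⟨k, φ, hφ, (mk_eq l e).symm⟩

/-- Generic cells are terminal in their component. -/
lemma exists_of_mk_eq (hδ : IsLaxGeneric T δ) {γ : δ ≫ T.map h ⟶ z} (hγ : IsGenericCell T γ)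
    {φ : δ ≫ T.map k ⟶ z} (e : mk φ = mk γ) : ∃ l : k ⟶ h, δ ◁ T.map₂ l ≫ γ = φ := by
  -- Equality of components only gives a zigzag of 2-cells, so the property of mapping to `γ` is
  -- shown to be invariant under each of its steps.
  let Q : Components δ z → Prop := Quot.lift
    (fun a : Cell δ z => ∃ l : a.arr ⟶ h, δ ◁ T.map₂ l ≫ γ = a.cell) (by
      rintro ⟨p, φ⟩ ⟨q, χ⟩ ⟨m, hm⟩
      dsimp only at m hm ⊢
      refine propext ⟨?_, ?_⟩
      · rintro ⟨l, hl⟩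
        -- The hull of `φ` receives both `γ` and `χ`. The map from `γ` is invertible because `γ` is
        -- generic, so `χ` maps to `γ` through the hull.
        obtain ⟨h₀, γ₀, ν, H, -, -, H'⟩ := hδ.exists_hull φ
        obtain ⟨l₁, h1, -⟩ := H' h γ l hl
        obtain ⟨l₂, h2, -⟩ := H' q χ m hm
        have := hγ.isIso H.subterminal l₁ h1
        refine ⟨l₂ ≫ inv l₁, ?_⟩
        rw [← h2, ← h1, whiskerLeft_map₂_comp, Category.assoc,
          ← Category.assoc (δ ◁ T.map₂ (inv l₁)), ← whiskerLeft_map₂_comp]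
        simp
      · rintro ⟨l, hl⟩
        exact ⟨m ≫ l, by rw [whiskerLeft_map₂_comp, Category.assoc, hl, hm]⟩)
  have h1 : Q (mk γ) := ⟨𝟙 h, by simp⟩
  rw [← e] at h1
  exact h1

/-- The action of a 2-cell on components. -/
def act {Y : B} {f g : X ⟶ Y} (ν : f ⟶ g) {σ : Y ⟶ T.obj A₂} (u : Components δ (f ≫ σ)) :
    Components δ (g ≫ σ) :=
  Quot.map (fun a : Cell δ (f ≫ σ) => (⟨a.arr, a.cell ≫ ν ▷ σ⟩ : Cell δ (g ≫ σ)))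
    (fun _ _ ⟨l, hl⟩ => ⟨l, by rw [← hl, Category.assoc]⟩) u

/-- The horizontal composition of components. -/
def hcomp {Y Z : B} {A₃ : A} {f : X ⟶ Y} {g : Y ⟶ Z} {σ : Y ⟶ T.obj A₂} {ω : Z ⟶ T.obj A₃}
    (u : Components δ (f ≫ σ)) (v : Components σ (g ≫ ω)) : Components δ ((f ≫ g) ≫ ω) :=
  Quot.map₂ (fun (a : Cell δ (f ≫ σ)) (b : Cell σ (g ≫ ω)) =>
      (⟨a.arr ≫ b.arr, hpaste T a.cell b.cell⟩ : Cell δ ((f ≫ g) ≫ ω)))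
    (fun a b c ⟨l, hl⟩ => ⟨a.arr ◁ l, by
      have := CellHom.hpaste_right a.cell (μ := 𝟙 _) (m := l) (φ := b.cell) (φ' := c.cell)
        (by simp [CellHom, hl])
      simpa [CellHom] using this⟩)
    (fun a b c ⟨l, hl⟩ => ⟨l ▷ c.arr, by
      have := CellHom.hpaste_left (ν := 𝟙 _) (l := l) (γ := a.cell) (γ' := b.cell)
        (by simp [CellHom, hl]) c.cell
      simpa [CellHom] using this⟩) u v

lemma act_mk {Y : B} {f g : X ⟶ Y} (ν : f ⟶ g) {σ : Y ⟶ T.obj A₂} (γ : δ ≫ T.map h ⟶ f ≫ σ) :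
    act ν (mk γ) = mk (γ ≫ ν ▷ σ) := rfl

lemma hcomp_mk {Y Z : B} {A₃ : A} {f : X ⟶ Y} {g : Y ⟶ Z} {σ : Y ⟶ T.obj A₂} {ω : Z ⟶ T.obj A₃}
    {m : A₂ ⟶ A₃} (γ : δ ≫ T.map h ⟶ f ≫ σ) (φ : σ ≫ T.map m ⟶ g ≫ ω) :
    hcomp (mk γ) (mk φ) = mk (hpaste T γ φ) := rfl

end Components

/-- The lax-generic 1-cells out of `X`. -/
structure LaxGeneric (T : A ⥤ᵖ B) (X : B) where
  /-- The object of `A`. -/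
  obj : A
  /-- The 1-cell. -/
  arr : X ⟶ T.obj obj
  isLaxGeneric : IsLaxGeneric T arr

/-- Cells into the target of an invertible 2-cell `i : σ · T p ⟶ f · ω` are determined up to
components by cells into `σ`. -/
lemma Components.exists_inverse {Y Z : B} {δ : X ⟶ T.obj A₁} (hδ : IsLaxGeneric T δ) (e : X ⟶ Y)
    (f : Y ⟶ Z) {A₃ : A} {σ : Y ⟶ T.obj A₃} {ω : Z ⟶ T.obj A₂} {p : A₃ ⟶ A₂}
    (i : σ ≫ T.map p ≅ f ≫ ω) :
    ∃ F : Components δ ((e ≫ f) ≫ ω) → Components δ (e ≫ σ),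
      (∀ (k : A₁ ⟶ A₃) (φ : δ ≫ T.map k ⟶ e ≫ σ), F (mk (hpaste T φ i.hom)) = mk φ) ∧
      ∀ u, ∃ (k : A₁ ⟶ A₃) (φ : δ ≫ T.map k ⟶ e ≫ σ), F u = mk φ ∧ mk (hpaste T φ i.hom) = u := by
  let c : (e ≫ σ) ≫ T.map p ≅ (e ≫ f) ≫ ω := α_ _ _ _ ≪≫ whiskerLeftIso e i ≪≫ (α_ _ _ _).symm
  have hc : ∀ {k : A₁ ⟶ A₃} (φ : δ ≫ T.map k ⟶ e ≫ σ),
      hpaste T φ i.hom = extend T φ p ≫ c.hom := by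
    intro k φ
    simp [hpaste_eq, c]
  -- The inverse sends a cell to the component of its universal factorization through `p`; by
  -- universality every other factorization lies in the same component.
  choose k φ ν H using fun a : Cell δ ((e ≫ f) ≫ ω) => hδ _ _ (e ≫ σ) a.arr p (a.cell ≫ c.inv)
  have key : ∀ (a : Cell δ ((e ≫ f) ≫ ω)) (q : A₁ ⟶ A₃) (χ : δ ≫ T.map q ⟶ e ≫ σ)
      (ψ : a.arr ⟶ q ≫ p), paste T χ ψ = a.cell ≫ c.inv → mk (φ a) = mk χ := by
    intro a q χ ψ h
    obtain ⟨l, hl, -⟩ := (H a).1.lift q χ ψ h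
    exact (mk_eq l hl).symm
  refine ⟨Quot.lift (fun a => mk (φ a)) ?_, ?_, ?_⟩
  · rintro a b ⟨l, hl⟩
    refine key a _ _ (l ≫ ν b) ?_
    rw [paste_eq, whiskerLeft_map₂_comp, Category.assoc, ← paste_eq, (H b).1.fac, ← hl,
      Category.assoc]
  · intro k φ
    exact key ⟨_, _⟩ k φ (𝟙 _) (by simp [paste_eq, hc])
  · intro u
    obtain ⟨a, rfl⟩ := Quot.exists_rep u
    refine ⟨k a, φ a, rfl, (mk_eq (ν a) ?_).symm⟩
    rw [hc, ← Category.assoc, ← paste_eq, (H a).1.fac]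
    simp

end Components

/-! ### The displayed structure of lax-generic 1-cells and components. -/

section DisplayedGeneric

variable {A : Type u₁} [Bicategory.{w₁, v₁} A] {B : Type u₂} [Bicategory.{w₂, v₂} B]
  {T : A ⥤ᵖ B} (hT : AdmitsLaxGenericFactorizations T)

open Components

/-- A lax-generic factorization. -/
lemma exists_laxGeneric {X : B} {C : A} (hT : AdmitsLaxGenericFactorizations T)
    (y : X ⟶ T.obj C) :
    ∃ (x : LaxGeneric T X) (f : x.obj ⟶ C), Nonempty (x.arr ≫ T.map f ≅ y) := by
  obtain ⟨A₁, δ, f, hδ, e⟩ := hT X C y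
  exact ⟨⟨A₁, δ, hδ⟩, f, e⟩

/-- The lax-generic 1-cells and the components of the cells between them, displayed over `B`. -/
noncomputable def genericDisplayed :
    Displayed.{w₂, v₂, u₂, max v₁ w₂, max u₁ v₂} B where
  Ob X := LaxGeneric T X
  Hom f x y := Components x.arr (f ≫ y.arr)
  act {_ _ _ _} ν {_ _} u := Components.act ν u
  id x := mk (unitCell T x.arr ≫ (λ_ x.arr).inv)
  comp u v := hcomp u v
  act_id u := by
    obtain ⟨h, γ, rfl⟩ := u.exists_rep
    rw [act_mk, id_whiskerRight, Category.comp_id]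
  act_act μ ν _ _ u := by
    obtain ⟨h, γ, rfl⟩ := u.exists_rep
    rw [act_mk, act_mk, act_mk, comp_whiskerRight, Category.assoc]
  comp_act_left ν _ _ _ _ u v := by
    obtain ⟨h, γ, rfl⟩ := u.exists_rep
    obtain ⟨k, φ, rfl⟩ := v.exists_rep
    have := CellHom.hpaste_left (CellHom.mk_comp ν γ) φ
    rw [act_mk, hcomp_mk, hcomp_mk, act_mk, ← this]
    exact (mk_eq (𝟙 h ▷ k) rfl).symm
  comp_act_right ν _ _ _ u v := by
    obtain ⟨h, γ, rfl⟩ := u.exists_rep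
    obtain ⟨k, φ, rfl⟩ := v.exists_rep
    have := CellHom.hpaste_right γ (CellHom.mk_comp ν φ)
    rw [act_mk, hcomp_mk, hcomp_mk, act_mk, ← this]
    exact (mk_eq (h ◁ 𝟙 k) rfl).symm
  assoc u v t := by
    obtain ⟨h, γ, rfl⟩ := u.exists_rep
    obtain ⟨k, φ, rfl⟩ := v.exists_rep
    obtain ⟨p, χ, rfl⟩ := t.exists_rep
    rw [hcomp_mk, hcomp_mk, hcomp_mk, hcomp_mk, act_mk]
    exact mk_eq (α_ _ _ _).hom (CellHom.hpaste_assoc γ φ χ)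
  id_comp u := by
    obtain ⟨h, γ, rfl⟩ := u.exists_rep
    rw [hcomp_mk, act_mk]
    exact mk_eq (λ_ _).hom (CellHom.hpaste_unit_left γ)
  comp_id u := by
    obtain ⟨h, γ, rfl⟩ := u.exists_rep
    rw [hcomp_mk, act_mk]
    exact mk_eq (ρ_ _).hom (CellHom.hpaste_unit_right γ)
  pull f y := (exists_laxGeneric hT (f ≫ y.arr)).choose
  cart f y := mk (exists_laxGeneric hT (f ≫ y.arr)).choose_spec.choose_spec.some.hom
  existsUnique_lift {_ _ _} e f {x y} u := by
    obtain ⟨F, hF, hF'⟩ := Components.exists_inverse x.isLaxGeneric e f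
      (exists_laxGeneric hT (f ≫ y.arr)).choose_spec.choose_spec.some
    obtain ⟨k, φ, -, hφ⟩ := hF' u
    refine ⟨mk φ, hφ, ?_⟩
    intro v hv
    obtain ⟨p, χ, rfl⟩ := v.exists_rep
    -- `F` is a left inverse of composition with the cartesian 1-cell, so that composition is
    -- injective.
    rw [← hF, ← hF]
    exact congrArg F (hv.trans hφ.symm)

end DisplayedGeneric

/-! ### Chosen generic cells and their coherence. -/

section Representatives

variable {A : Type u₁} [Bicategory.{w₁, v₁} A] {B : Type u₂} [Bicategory.{w₂, v₂} B]
  {T : A ⥤ᵖ B}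

open Components

section

variable {X : B} {A₁ A₂ : A} {δ : X ⟶ T.obj A₁} {z z' : X ⟶ T.obj A₂} {h k : A₁ ⟶ A₂}

lemma IsGenericCell.comp_iso {γ : δ ≫ T.map h ⟶ z} (hγ : IsGenericCell T γ) (j : z ≅ z') :
    IsGenericCell T (γ ≫ j.hom) where
  subterminal p ω τ e := by
    apply hγ.subterminal
    rw [← cancel_mono j.hom]
    simpa using e
  retract p φ l e := by
    obtain ⟨l', h1, h2⟩ := hγ.retract p (φ ≫ j.inv) l (by
      rw [← Category.assoc, e, Category.assoc, j.hom_inv_id, Category.comp_id])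
    exact ⟨l', by rw [← Category.assoc, h1]; simp, h2⟩

/-- Generic cells in the same component are isomorphic. -/
lemma exists_iso_of_mk_eq (hδ : IsLaxGeneric T δ) {γ : δ ≫ T.map h ⟶ z} (hγ : IsGenericCell T γ)
    {φ : δ ≫ T.map k ⟶ z} (hφ : IsGenericCell T φ) (e : mk γ = mk φ) :
    ∃ l : h ≅ k, δ ◁ T.map₂ l.hom ≫ φ = γ := by
  obtain ⟨l, hl⟩ := exists_of_mk_eq hδ hφ e
  have := hγ.isIso hφ.subterminal l hl
  exact ⟨asIso l, hl⟩

end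

variable {X Y Z W : B} {x : LaxGeneric T X} {y : LaxGeneric T Y} {z : LaxGeneric T Z}
  {w : LaxGeneric T W} {f f' f'' : X ⟶ Y} {g g' : Y ⟶ Z} {e : Z ⟶ W}

namespace Components

/-- The 1-cell of a chosen generic cell in a component. -/
noncomputable def arr (u : Components x.arr (f ≫ y.arr)) : x.obj ⟶ y.obj :=
  (exists_isGenericCell x.isLaxGeneric u).choose

/-- A chosen generic cell in a component. -/
noncomputable def cell (u : Components x.arr (f ≫ y.arr)) :
    x.arr ≫ T.map u.arr ⟶ f ≫ y.arr :=
  (exists_isGenericCell x.isLaxGeneric u).choose_spec.choose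

lemma isGenericCell_cell (u : Components x.arr (f ≫ y.arr)) : IsGenericCell T u.cell :=
  (exists_isGenericCell x.isLaxGeneric u).choose_spec.choose_spec.1

lemma mk_cell (u : Components x.arr (f ≫ y.arr)) : mk u.cell = u :=
  (exists_isGenericCell x.isLaxGeneric u).choose_spec.choose_spec.2

/-- An invertible cell in the component makes the chosen generic cell invertible. -/
lemma isIso_cell_of_eq_mk (u : Components x.arr (f ≫ y.arr)) {h : x.obj ⟶ y.obj}
    (γ : x.arr ≫ T.map h ⟶ f ≫ y.arr) [IsIso γ] (e : u = mk γ) : IsIso u.cell := by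
  obtain ⟨l, hl⟩ := exists_iso_of_mk_eq x.isLaxGeneric u.isGenericCell_cell
    (x.isLaxGeneric.isGenericCell_of_isIso γ) (u.mk_cell.trans e)
  rw [← hl]
  infer_instance

lemma exists_map₂ (ν : f ⟶ f') (u : Components x.arr (f ≫ y.arr))
    (u' : Components x.arr (f' ≫ y.arr)) (h : act ν u = u') :
    ∃ l : u.arr ⟶ u'.arr, CellHom T ν l u.cell u'.cell := by
  obtain ⟨l, hl⟩ := exists_of_mk_eq (φ := u.cell ≫ ν ▷ y.arr) x.isLaxGeneric u'.isGenericCell_cell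
    (by rw [mk_cell, ← act_mk, mk_cell, h])
  exact ⟨l, hl⟩

/-- The comparison of the chosen generic cells over a 2-cell. -/
noncomputable def map₂ (ν : f ⟶ f') (u : Components x.arr (f ≫ y.arr))
    (u' : Components x.arr (f' ≫ y.arr)) (h : act ν u = u') : u.arr ⟶ u'.arr :=
  (exists_map₂ ν u u' h).choose

lemma map₂_cellHom (ν : f ⟶ f') (u : Components x.arr (f ≫ y.arr))
    (u' : Components x.arr (f' ≫ y.arr)) (h : act ν u = u') :
    CellHom T ν (map₂ ν u u' h) u.cell u'.cell :=
  (exists_map₂ ν u u' h).choose_spec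

lemma exists_mapId (u : Components x.arr (𝟙 X ≫ x.arr))
    (h : u = mk (unitCell T x.arr ≫ (λ_ x.arr).inv)) :
    ∃ l : u.arr ≅ 𝟙 x.obj, CellHom T (𝟙 (𝟙 X)) l.hom u.cell (unitCell T x.arr ≫ (λ_ x.arr).inv) := by
  obtain ⟨l, hl⟩ := exists_iso_of_mk_eq x.isLaxGeneric u.isGenericCell_cell
    (x.isLaxGeneric.isGenericCell_of_isIso (unitCell T x.arr ≫ (λ_ x.arr).inv)) (u.mk_cell.trans h)
  exact ⟨l, by simp [CellHom, hl]⟩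

/-- The comparison of the chosen generic cell with the identity cell. -/
noncomputable def mapId (u : Components x.arr (𝟙 X ≫ x.arr))
    (h : u = mk (unitCell T x.arr ≫ (λ_ x.arr).inv)) : u.arr ≅ 𝟙 x.obj :=
  (exists_mapId u h).choose

lemma mapId_cellHom (u : Components x.arr (𝟙 X ≫ x.arr))
    (h : u = mk (unitCell T x.arr ≫ (λ_ x.arr).inv)) :
    CellHom T (𝟙 (𝟙 X)) (mapId u h).hom u.cell (unitCell T x.arr ≫ (λ_ x.arr).inv) :=
  (exists_mapId u h).choose_spec

lemma mapId_inv_cellHom (u : Components x.arr (𝟙 X ≫ x.arr))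
    (h : u = mk (unitCell T x.arr ≫ (λ_ x.arr).inv)) :
    CellHom T (𝟙 (𝟙 X)) (mapId u h).inv (unitCell T x.arr ≫ (λ_ x.arr).inv) u.cell :=
  CellHom.symm (ν := Iso.refl _) (mapId_cellHom u h)

end Components

variable (hT : GenericCellsCompose T)

include hT

/-- The one place where the construction of `M`, `P` and `η` appeals to (b). -/
lemma isGenericCell_hpaste (u : Components x.arr (f ≫ y.arr)) (v : Components y.arr (g ≫ z.arr)) :
    IsGenericCell T (hpaste T u.cell v.cell) :=
  hT _ _ _ _ _ _ _ _ _ _ _ _ _ _ _ x.isLaxGeneric y.isLaxGeneric z.isLaxGeneric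
    u.isGenericCell_cell v.isGenericCell_cell

namespace Components

lemma exists_mapComp (u : Components x.arr (f ≫ y.arr)) (v : Components y.arr (g ≫ z.arr))
    (t : Components x.arr ((f ≫ g) ≫ z.arr)) (h : t = hcomp u v) :
    ∃ l : t.arr ≅ u.arr ≫ v.arr, CellHom T (𝟙 (f ≫ g)) l.hom t.cell (hpaste T u.cell v.cell) := by
  obtain ⟨l, hl⟩ := exists_iso_of_mk_eq x.isLaxGeneric t.isGenericCell_cell
    (isGenericCell_hpaste hT u v) (by rw [← hcomp_mk, mk_cell, mk_cell, mk_cell, h])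
  exact ⟨l, by simp [CellHom, hl]⟩

/-- The comparison of the chosen generic cell with a pasting of chosen generic cells. -/
noncomputable def mapComp (u : Components x.arr (f ≫ y.arr)) (v : Components y.arr (g ≫ z.arr))
    (t : Components x.arr ((f ≫ g) ≫ z.arr)) (h : t = hcomp u v) : t.arr ≅ u.arr ≫ v.arr :=
  (exists_mapComp hT u v t h).choose

lemma mapComp_cellHom (u : Components x.arr (f ≫ y.arr)) (v : Components y.arr (g ≫ z.arr))
    (t : Components x.arr ((f ≫ g) ≫ z.arr)) (h : t = hcomp u v) :
    CellHom T (𝟙 (f ≫ g)) (mapComp hT u v t h).hom t.cell (hpaste T u.cell v.cell) :=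
  (exists_mapComp hT u v t h).choose_spec

lemma mapComp_inv_cellHom (u : Components x.arr (f ≫ y.arr)) (v : Components y.arr (g ≫ z.arr))
    (t : Components x.arr ((f ≫ g) ≫ z.arr)) (h : t = hcomp u v) :
    CellHom T (𝟙 (f ≫ g)) (mapComp hT u v t h).inv (hpaste T u.cell v.cell) t.cell :=
  CellHom.symm (ν := Iso.refl _) (mapComp_cellHom hT u v t h)

omit hT in
-- As in the laws that follow, both sides are morphisms over the same 2-cell of `B` into the same
-- generic cell, so they agree.
lemma map₂_id (u : Components x.arr (f ≫ y.arr)) (h : act (𝟙 f) u = u) :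
    map₂ (𝟙 f) u u h = 𝟙 _ :=
  CellHom.unique u.isGenericCell_cell (map₂_cellHom _ _ _ h) (CellHom.refl _)

omit hT in
lemma map₂_comp (ν : f ⟶ f') (μ : f' ⟶ f'') (u : Components x.arr (f ≫ y.arr))
    (u' : Components x.arr (f' ≫ y.arr)) (u'' : Components x.arr (f'' ≫ y.arr))
    (h : act ν u = u') (h' : act μ u' = u'') (h'' : act (ν ≫ μ) u = u'') :
    map₂ (ν ≫ μ) u u'' h'' = map₂ ν u u' h ≫ map₂ μ u' u'' h' :=
  CellHom.unique u''.isGenericCell_cell (map₂_cellHom _ _ _ _)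
    ((map₂_cellHom ν u u' h).comp (map₂_cellHom μ u' u'' h'))

lemma map₂_whiskerLeft (u : Components x.arr (f ≫ y.arr)) (ν : g ⟶ g')
    (v : Components y.arr (g ≫ z.arr)) (v' : Components y.arr (g' ≫ z.arr)) (h : act ν v = v')
    (t : Components x.arr ((f ≫ g) ≫ z.arr)) (t' : Components x.arr ((f ≫ g') ≫ z.arr))
    (ht : t = hcomp u v) (ht' : t' = hcomp u v') (h' : act (f ◁ ν) t = t') :
    map₂ (f ◁ ν) t t' h' =
      (mapComp hT u v t ht).hom ≫ u.arr ◁ map₂ ν v v' h ≫ (mapComp hT u v' t' ht').inv :=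
  CellHom.unique t'.isGenericCell_cell (map₂_cellHom _ _ _ _)
    ((mapComp_cellHom hT u v t ht).trans (((map₂_cellHom ν v v' h).hpaste_right u.cell).trans
      (mapComp_inv_cellHom hT u v' t' ht') rfl) (by simp))

lemma map₂_whiskerRight (ν : f ⟶ f') (u : Components x.arr (f ≫ y.arr))
    (u' : Components x.arr (f' ≫ y.arr)) (h : act ν u = u') (v : Components y.arr (g ≫ z.arr))
    (t : Components x.arr ((f ≫ g) ≫ z.arr)) (t' : Components x.arr ((f' ≫ g) ≫ z.arr))
    (ht : t = hcomp u v) (ht' : t' = hcomp u' v) (h' : act (ν ▷ g) t = t') :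
    map₂ (ν ▷ g) t t' h' =
      (mapComp hT u v t ht).hom ≫ map₂ ν u u' h ▷ v.arr ≫ (mapComp hT u' v t' ht').inv :=
  CellHom.unique t'.isGenericCell_cell (map₂_cellHom _ _ _ _)
    ((mapComp_cellHom hT u v t ht).trans (((map₂_cellHom ν u u' h).hpaste_left v.cell).trans
      (mapComp_inv_cellHom hT u' v t' ht') rfl) (by simp))

lemma map₂_associator (u : Components x.arr (f ≫ y.arr)) (v : Components y.arr (g ≫ z.arr))
    (t : Components z.arr (e ≫ w.arr)) (uv : Components x.arr ((f ≫ g) ≫ z.arr))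
    (vt : Components y.arr ((g ≫ e) ≫ w.arr)) (uvt : Components x.arr (((f ≫ g) ≫ e) ≫ w.arr))
    (uvt' : Components x.arr ((f ≫ g ≫ e) ≫ w.arr)) (h₁ : uv = hcomp u v) (h₂ : vt = hcomp v t)
    (h₃ : uvt = hcomp uv t) (h₄ : uvt' = hcomp u vt) (h : act (α_ f g e).hom uvt = uvt') :
    map₂ (α_ f g e).hom uvt uvt' h =
      (mapComp hT uv t uvt h₃).hom ≫ (mapComp hT u v uv h₁).hom ▷ t.arr ≫ (α_ _ _ _).hom ≫
        u.arr ◁ (mapComp hT v t vt h₂).inv ≫ (mapComp hT u vt uvt' h₄).inv :=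
  CellHom.unique uvt'.isGenericCell_cell (map₂_cellHom _ _ _ _)
    ((mapComp_cellHom hT uv t uvt h₃).trans
      (((mapComp_cellHom hT u v uv h₁).hpaste_left t.cell).trans
        ((CellHom.hpaste_assoc u.cell v.cell t.cell).trans
          (((mapComp_inv_cellHom hT v t vt h₂).hpaste_right u.cell).trans
            (mapComp_inv_cellHom hT u vt uvt' h₄) rfl) rfl) rfl) (by simp))

lemma map₂_leftUnitor (u : Components x.arr (f ≫ y.arr)) (i : Components x.arr (𝟙 X ≫ x.arr))
    (t : Components x.arr ((𝟙 X ≫ f) ≫ y.arr))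
    (hi : i = mk (unitCell T x.arr ≫ (λ_ x.arr).inv)) (ht : t = hcomp i u)
    (h : act (λ_ f).hom t = u) :
    map₂ (λ_ f).hom t u h =
      (mapComp hT i u t ht).hom ≫ (mapId i hi).hom ▷ u.arr ≫ (λ_ u.arr).hom :=
  CellHom.unique u.isGenericCell_cell (map₂_cellHom _ _ _ _)
    ((mapComp_cellHom hT i u t ht).trans (((mapId_cellHom i hi).hpaste_left u.cell).trans
      (CellHom.hpaste_unit_left u.cell) rfl) (by simp))

lemma map₂_rightUnitor (u : Components x.arr (f ≫ y.arr)) (i : Components y.arr (𝟙 Y ≫ y.arr))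
    (t : Components x.arr ((f ≫ 𝟙 Y) ≫ y.arr))
    (hi : i = mk (unitCell T y.arr ≫ (λ_ y.arr).inv)) (ht : t = hcomp u i)
    (h : act (ρ_ f).hom t = u) :
    map₂ (ρ_ f).hom t u h =
      (mapComp hT u i t ht).hom ≫ u.arr ◁ (mapId i hi).hom ≫ (ρ_ u.arr).hom :=
  CellHom.unique u.isGenericCell_cell (map₂_cellHom _ _ _ _)
    ((mapComp_cellHom hT u i t ht).trans (((mapId_cellHom i hi).hpaste_right u.cell).trans
      (CellHom.hpaste_unit_right u.cell) rfl) (by simp))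

end Components

omit hT in
-- The pasting `h₂` makes `γ` a split epimorphism, and this survives whiskering; the pasting `h₁`
-- makes the whiskered `γ` a monomorphism. So the whiskered `γ` is invertible, and `φ` follows by
-- cancellation.
lemma isIso_of_isIso_hpaste {A₁ A₂ : A} {δ : X ⟶ T.obj A₁}
    {σ : X ⟶ T.obj A₂} {h : A₁ ⟶ A₂} {k : A₂ ⟶ A₁} (γ : δ ≫ T.map h ⟶ 𝟙 X ≫ σ)
    (φ : σ ≫ T.map k ⟶ 𝟙 X ≫ δ) (h₁ : IsIso (hpaste T γ φ)) (h₂ : IsIso (hpaste T φ γ)) :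
    IsIso φ := by
  have aux : ∀ {A₁ A₂ A₃ : A} {δ : X ⟶ T.obj A₁} {σ : X ⟶ T.obj A₂} {ω : X ⟶ T.obj A₃}
      {h : A₁ ⟶ A₂} {k : A₂ ⟶ A₃} (γ : δ ≫ T.map h ⟶ 𝟙 X ≫ σ) (φ : σ ≫ T.map k ⟶ 𝟙 X ≫ ω),
      IsIso (hpaste T γ φ) → IsIso (γ ▷ T.map k ≫ (λ_ σ).hom ▷ T.map k ≫ φ) := by
    intro A₁ A₂ A₃ δ σ ω h k γ φ hi
    have : γ ▷ T.map k ≫ (λ_ σ).hom ▷ T.map k ≫ φ = inv (δ ◁ (T.mapComp h k).hom ≫ (α_ _ _ _).inv) ≫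
        hpaste T γ φ ≫ (α_ _ _ _).hom ≫ (λ_ _).hom := by
      rw [IsIso.eq_inv_comp]
      simp [hpaste]
    rw [this]
    infer_instance
  have h3 := aux γ φ h₁
  have h4 := aux φ γ h₂
  have hγ : IsSplitEpi γ := by
    refine IsSplitEpi.mk' ⟨inv (φ ▷ T.map h ≫ (λ_ δ).hom ▷ T.map h ≫ γ) ≫
      φ ▷ T.map h ≫ (λ_ δ).hom ▷ T.map h, ?_⟩
    simp only [Category.assoc, IsIso.inv_hom_id]
  have h5 : IsSplitEpi (γ ▷ T.map k) :=
    IsSplitEpi.mk' ⟨section_ γ ▷ T.map k, by rw [← comp_whiskerRight, IsSplitEpi.id]; simp⟩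
  have h6 : Mono (γ ▷ T.map k) := mono_of_mono (γ ▷ T.map k) ((λ_ σ).hom ▷ T.map k ≫ φ)
  have h7 : IsIso (γ ▷ T.map k) := isIso_of_mono_of_isSplitEpi _
  have h8 := IsIso.of_isIso_comp_left (γ ▷ T.map k) ((λ_ σ).hom ▷ T.map k ≫ φ)
  exact IsIso.of_isIso_comp_left ((λ_ σ).hom ▷ T.map k) φ

/-- An isomorphism of the fibre is represented by an invertible cell: both pastings with the cell of
the inverse are generic and lie, up to a unitor, in the component of an invertible unit cell, so
they are invertible. -/
lemma isIso_cell_of_inverse {x' : LaxGeneric T X} (v : Components x.arr (𝟙 X ≫ x'.arr))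
    (t : Components x'.arr (𝟙 X ≫ x.arr))
    (h₁ : act (λ_ (𝟙 X)).hom (hcomp v t) = mk (unitCell T x.arr ≫ (λ_ x.arr).inv))
    (h₂ : act (λ_ (𝟙 X)).hom (hcomp t v) = mk (unitCell T x'.arr ≫ (λ_ x'.arr).inv)) :
    IsIso v.cell := by
  have aux : ∀ {x x' : LaxGeneric T X} (v : Components x.arr (𝟙 X ≫ x'.arr))
      (t : Components x'.arr (𝟙 X ≫ x.arr)),
      act (λ_ (𝟙 X)).hom (hcomp v t) = mk (unitCell T x.arr ≫ (λ_ x.arr).inv) →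
      IsIso (hpaste T v.cell t.cell) := by
    intro x x' v t h
    have h3 : mk ((hpaste T v.cell t.cell) ≫ (λ_ (𝟙 X)).hom ▷ x.arr) =
        mk (unitCell T x.arr ≫ (λ_ x.arr).inv) := by
      rw [← act_mk, ← hcomp_mk, mk_cell, mk_cell, h]
    obtain ⟨l, hl⟩ := exists_iso_of_mk_eq x.isLaxGeneric
      ((isGenericCell_hpaste hT v t).comp_iso (whiskerRightIso (λ_ (𝟙 X)) x.arr))
      (x.isLaxGeneric.isGenericCell_of_isIso (unitCell T x.arr ≫ (λ_ x.arr).inv)) h3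
    have : IsIso (hpaste T v.cell t.cell ≫ (whiskerRightIso (λ_ (𝟙 X)) x.arr).hom) := by
      rw [← hl]; infer_instance
    exact IsIso.of_isIso_comp_right _ (whiskerRightIso (λ_ (𝟙 X)) x.arr).hom
  exact isIso_of_isIso_hpaste t.cell v.cell (aux t v h₂) (aux v t h₁)

end Representatives

/-! ### A criterion for universality of a lax cocone. -/

section ComparisonEquivalence

variable {A : Type u₁} [Bicategory.{w₁, v₁} A] {B : Type u₂} [Bicategory.{w₂, v₂} B]
  {T : A ⥤ᵖ B} {N : Type u'} [Category.{v'} N]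
  {Q : LocallyDiscrete N ⥤ᵖ A} {X : B} (κ : Cocone T X Q)

/-- A lax cocone whose legs are lax-generic and whose cells represent the generic cells between
the legs is universal. -/
lemma Cocone.comparison_isEquivalence (hleg : ∀ m, IsLaxGeneric T (κ.app m))
    (hcell : ∀ {m n : LocallyDiscrete N} (u : m ⟶ n), IsGenericCell T (κ.cell u))
    (hinj : ∀ {m n : LocallyDiscrete N} (u u' : m ⟶ n) (l : Q.map u ⟶ Q.map u'),
      κ.app m ◁ T.map₂ l ≫ κ.cell u' = κ.cell u → u = u')
    (hsurj : ∀ {m n : LocallyDiscrete N} {h : Q.obj m ⟶ Q.obj n} (γ : κ.app m ≫ T.map h ⟶ κ.app n),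
      ∃ (u : m ⟶ n) (l : h ⟶ Q.map u), κ.app m ◁ T.map₂ l ≫ κ.cell u = γ)
    (hess : ∀ {C : A} (y : X ⟶ T.obj C), ∃ (m : LocallyDiscrete N) (f : Q.obj m ⟶ C),
      Nonempty (κ.app m ≫ T.map f ≅ y)) (C : A) : (κ.comparison C).IsEquivalence where
  faithful := ⟨by
    rintro ⟨m, x⟩ ⟨n, y⟩ ⟨u, ν⟩ ⟨u', ν'⟩ h
    -- Both pastings factor the same 2-cell and `κ.cell u` is generic, so the second factorization
    -- maps to the first by some `l`; then `u' = u`, and subterminality forces `l` to be an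
    -- identity.
    obtain ⟨l, h1, h2⟩ := ((hcell u).isUniversalFactorization (hleg m) ν).lift _ (κ.cell u') ν' h.symm
    obtain rfl : u' = u := hinj u' u l h1
    have h3 : l = 𝟙 _ := (hcell u').subterminal _ _ _ (by rw [h1]; simp)
    rw [h3, id_whiskerRight] at h2
    have h4 : ν' = ν := (Category.comp_id ν').symm.trans h2
    rw [h4]⟩
  full := ⟨by
    rintro ⟨m, x⟩ ⟨n, y⟩ α
    obtain ⟨h, γ, ν, H, -⟩ := hleg m _ _ (κ.app n) x y α
    obtain ⟨u, l, hl⟩ := hsurj γ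
    refine ⟨Rep.homMk u (ν ≫ l ▷ y), ?_⟩
    rw [← H.fac, ← hl]
    change paste T (κ.cell u) (ν ≫ l ▷ y) = _
    rw [paste_eq, paste_eq, extend_precomp, whiskerLeft_map₂_comp, Category.assoc]⟩
  essSurj := ⟨fun y => by
    obtain ⟨m, f, e⟩ := hess y
    exact ⟨⟨m, f⟩, e⟩⟩

end ComparisonEquivalence

/-! ### The pseudofunctor `P` on the Grothendieck construction. -/

section Backward

variable {A : Type u₁} [Bicategory.{w₁, v₁} A] {B : Type u₂} [Bicategory.{w₂, v₂} B]
  {T : A ⥤ᵖ B} (hT : AdmitsLaxGenericFactorizations T) (hT' : GenericCellsCompose T)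

open Displayed

/-- The lax-generic 1-cell of an object of the Grothendieck construction. -/
noncomputable def genericOb (x : El (genericDisplayed hT).fibres) : LaxGeneric T x.base := ob x

/-- The component of cells of a 1-cell of the Grothendieck construction. -/
noncomputable def genericTot {x y : El (genericDisplayed hT).fibres} (φ : x ⟶ y) :
    Components (genericOb hT x).arr (φ.base ≫ (genericOb hT y).arr) := tot φ

/-- The pseudofunctor given by the chosen generic cells. -/
noncomputable def genericPseudofunctor : El (genericDisplayed hT).fibres ⥤ᵖ A where
  obj x := (genericOb hT x).obj
  map φ := (genericTot hT φ).arr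
  map₂ {_ _ φ ψ} σ := Components.map₂ σ.base (genericTot hT φ) (genericTot hT ψ) (act_tot σ)
  map₂_id φ := Components.map₂_id (genericTot hT φ) _
  map₂_comp {_ _ φ ψ χ} σ τ := Components.map₂_comp σ.base τ.base (genericTot hT φ)
    (genericTot hT ψ) (genericTot hT χ) (act_tot σ) (act_tot τ) _
  mapId x := Components.mapId (genericTot hT (𝟙 x)) (tot_id x)
  mapComp φ ψ := Components.mapComp hT' (genericTot hT φ) (genericTot hT ψ)
    (genericTot hT (φ ≫ ψ)) (tot_comp φ ψ)
  map₂_whisker_left φ _ _ σ := Components.map₂_whiskerLeft hT' (genericTot hT φ) σ.base _ _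
    (act_tot σ) _ _ (tot_comp φ _) (tot_comp φ _) _
  map₂_whisker_right σ χ := Components.map₂_whiskerRight hT' σ.base _ _ (act_tot σ)
    (genericTot hT χ) _ _ (tot_comp _ χ) (tot_comp _ χ) _
  map₂_associator φ ψ χ := Components.map₂_associator hT' (genericTot hT φ) (genericTot hT ψ)
    (genericTot hT χ) (genericTot hT (φ ≫ ψ)) (genericTot hT (ψ ≫ χ)) (genericTot hT ((φ ≫ ψ) ≫ χ))
    (genericTot hT (φ ≫ ψ ≫ χ)) (tot_comp _ _) (tot_comp _ _) (tot_comp _ _) (tot_comp _ _)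
    (act_tot (α_ φ ψ χ).hom)
  map₂_left_unitor {x _} φ := Components.map₂_leftUnitor hT' (genericTot hT φ)
    (genericTot hT (𝟙 x)) (genericTot hT (𝟙 x ≫ φ)) (tot_id x) (tot_comp _ _)
    (act_tot (λ_ φ).hom)
  map₂_right_unitor {_ y} φ := Components.map₂_rightUnitor hT' (genericTot hT φ)
    (genericTot hT (𝟙 y)) (genericTot hT (φ ≫ 𝟙 y)) (tot_id y) (tot_comp _ _)
    (act_tot (ρ_ φ).hom)

end Backward

/-! ### Lax naturality, invertibility and vertical parts of the chosen cells. -/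

section Representatives

variable {A : Type u₁} [Bicategory.{w₁, v₁} A] {B : Type u₂} [Bicategory.{w₂, v₂} B]
  {T : A ⥤ᵖ B} {X Y Z : B} {x x' : LaxGeneric T X} {y : LaxGeneric T Y} {z : LaxGeneric T Z}
  {f : X ⟶ Y} {g : Y ⟶ Z}

namespace Components

lemma cell_naturality_id (u : Components x.arr (𝟙 X ≫ x.arr))
    (h : u = mk (unitCell T x.arr ≫ (λ_ x.arr).inv)) :
    x.arr ◁ ((T.mapId x.obj).inv ≫ T.map₂ (mapId u h).inv) ≫ u.cell =
      (ρ_ x.arr).hom ≫ (λ_ x.arr).inv ≫ 𝟙 (𝟙 X) ▷ x.arr := by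
  have h1 := mapId_inv_cellHom u h
  rw [CellHom] at h1
  rw [whiskerLeft_comp, Category.assoc, h1]
  simp [unitCell]

lemma cell_naturality_comp (hT : GenericCellsCompose T) (u : Components x.arr (f ≫ y.arr))
    (v : Components y.arr (g ≫ z.arr)) (t : Components x.arr ((f ≫ g) ≫ z.arr))
    (h : t = hcomp u v) :
    x.arr ◁ ((T.mapComp u.arr v.arr).inv ≫ T.map₂ (mapComp hT u v t h).inv) ≫ t.cell =
      (α_ _ _ _).inv ≫ u.cell ▷ T.map v.arr ≫ (α_ _ _ _).hom ≫ f ◁ v.cell ≫ (α_ _ _ _).inv ≫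
        𝟙 (f ≫ g) ▷ z.arr := by
  have h1 := mapComp_inv_cellHom hT u v t h
  rw [CellHom] at h1
  rw [whiskerLeft_comp, Category.assoc, h1]
  simp [hpaste]

lemma isIso_cell_of_eq_hcomp (v : Components x.arr (𝟙 X ≫ x'.arr)) (hv : IsIso v.cell)
    {p : x'.obj ⟶ y.obj} (i : x'.arr ≫ T.map p ≅ f ≫ y.arr) (u : Components x.arr (f ≫ y.arr))
    (hu : u = act (λ_ f).hom (hcomp v (mk i.hom))) : IsIso u.cell := by
  have : IsIso (hpaste T v.cell i.hom ≫ (λ_ f).hom ▷ y.arr) := by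
    unfold hpaste
    infer_instance
  exact u.isIso_cell_of_eq_mk (hpaste T v.cell i.hom ≫ (λ_ f).hom ▷ y.arr)
    (by rw [hu, ← act_mk, ← hcomp_mk, mk_cell])

/-- The chosen generic cell in a component of vertical cells. -/
noncomputable def vertCell (u : Components x.arr (𝟙 X ≫ x'.arr)) :
    x.arr ≫ T.map u.arr ⟶ x'.arr :=
  u.cell ≫ (λ_ x'.arr).hom

lemma isGenericCell_vertCell (u : Components x.arr (𝟙 X ≫ x'.arr)) :
    IsGenericCell T u.vertCell :=
  u.isGenericCell_cell.comp_iso (λ_ x'.arr)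

lemma eq_of_vertCell {u u' : Components x.arr (𝟙 X ≫ x'.arr)} (l : u.arr ⟶ u'.arr)
    (h : x.arr ◁ T.map₂ l ≫ u'.vertCell = u.vertCell) : u = u' := by
  rw [← u.mk_cell, ← u'.mk_cell]
  refine mk_eq l ?_
  rw [← cancel_mono (λ_ x'.arr).hom, Category.assoc]
  exact h

lemma exists_vertCell {h : x.obj ⟶ x'.obj} (γ : x.arr ≫ T.map h ⟶ x'.arr)
    (u : Components x.arr (𝟙 X ≫ x'.arr)) (e : u = mk (γ ≫ (λ_ x'.arr).inv)) :
    ∃ l : h ⟶ u.arr, x.arr ◁ T.map₂ l ≫ u.vertCell = γ := by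
  obtain ⟨l, hl⟩ := exists_of_mk_eq x.isLaxGeneric u.isGenericCell_cell (e.symm.trans u.mk_cell.symm)
  refine ⟨l, ?_⟩
  rw [vertCell, ← Category.assoc, hl]
  simp

end Components

end Representatives

/-! ### The universal lax transformation. -/

section Backward

variable {A : Type u₁} [Bicategory.{w₁, v₁} A] {B : Type u₂} [Bicategory.{w₂, v₂} B]
  {T : A ⥤ᵖ B} (hT : AdmitsLaxGenericFactorizations T) (hT' : GenericCellsCompose T)

open Displayed

/-- The lax transformation given by the chosen generic cells. -/
noncomputable def genericTrans : Lax.LaxTrans (El.proj (genericDisplayed hT).fibres).toLax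
    ((genericPseudofunctor hT hT').comp T).toLax where
  app x := (genericOb hT x).arr
  naturality φ := (genericTot hT φ).cell
  naturality_naturality {_ _ φ ψ} σ :=
    Eq.symm (Components.map₂_cellHom σ.base (genericTot hT φ) (genericTot hT ψ) (act_tot σ))
  naturality_id x := Components.cell_naturality_id (genericTot hT (𝟙 x)) (tot_id x)
  naturality_comp φ ψ := Components.cell_naturality_comp hT' (genericTot hT φ) (genericTot hT ψ)
    (genericTot hT (φ ≫ ψ)) (tot_comp φ ψ)

include hT' in
-- A cartesian 1-cell of the Grothendieck construction is a vertical isomorphism followed by a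
-- chosen lift. Both have invertible cells, and an invertible cell in a component makes its chosen
-- generic cell invertible.
lemma isIso_cell_vcomp_cart {X Y : B} {x : LaxGeneric T X} {y : LaxGeneric T Y} (f : X ⟶ Y)
    (v : (genericDisplayed hT).Hom (𝟙 X) x ((genericDisplayed hT).pull f y))
    (t : (genericDisplayed hT).Hom (𝟙 X) ((genericDisplayed hT).pull f y) x)
    (h₁ : (genericDisplayed hT).vcomp v t = (genericDisplayed hT).id x)
    (h₂ : (genericDisplayed hT).vcomp t v = (genericDisplayed hT).id _)
    (u : Components x.arr (f ≫ y.arr))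
    (hu : u = (genericDisplayed hT).vcomp v ((genericDisplayed hT).cart f y)) : IsIso u.cell :=
  Components.isIso_cell_of_eq_hcomp (x' := (exists_laxGeneric hT (f ≫ y.arr)).choose) v
    (isIso_cell_of_inverse hT' (x := x) (x' := (genericDisplayed hT).pull f y) v t h₁ h₂)
    (exists_laxGeneric hT (f ≫ y.arr)).choose_spec.choose_spec.some u hu

lemma isIso_genericTrans {x y : El (genericDisplayed hT).fibres} (φ : x ⟶ y)
    (h : IsIso φ.fiber) : IsIso ((genericTrans hT hT').naturality φ) :=
  isIso_cell_vcomp_cart hT hT' φ.base (vert φ) (inv φ.fiber) (IsIso.hom_inv_id φ.fiber)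
    (IsIso.inv_hom_id φ.fiber) (genericTot hT φ) rfl

/-- The component of cells of a morphism of a fibre. -/
noncomputable def fibreComponent {X : B}
    {m n : LocallyDiscrete ((genericDisplayed hT).fibres.obj (op X))} (u : m ⟶ n) :
    Components (genericOb hT ⟨X, m.as⟩).arr (𝟙 X ≫ (genericOb hT ⟨X, n.as⟩).arr) :=
  u.as

lemma genericTot_inclMap {X : B}
    {m n : LocallyDiscrete ((genericDisplayed hT).fibres.obj (op X))} (u : m ⟶ n) :
    genericTot hT (El.inclMap (genericDisplayed hT).fibres u.as) = fibreComponent hT u :=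
  tot_inclMap u.as

lemma fibreCocone_genericTrans_cell {X : B}
    {m n : LocallyDiscrete ((genericDisplayed hT).fibres.obj (op X))} (u : m ⟶ n) :
    (fibreCocone (genericTrans hT hT') X).cell u =
      Components.vertCell (x := genericOb hT ⟨X, m.as⟩) (x' := genericOb hT ⟨X, n.as⟩)
        (genericTot hT (El.inclMap (genericDisplayed hT).fibres u.as)) := by
  have : ∀ {X : B} {x x' : LaxGeneric T X} (t : Components x.arr (𝟙 X ≫ x'.arr)),
      t.cell ≫ 𝟙 (𝟙 X) ▷ x'.arr ≫ (λ_ x'.arr).hom = t.vertCell := by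
    intro X x x' t
    simp [Components.vertCell]
  exact this _

/-- Morphisms of the fibre are components of cells, so cells between legs are covered by exactly one
morphism each; essential surjectivity is (a). -/
lemma isEquivalence_genericTrans (X : B) (C : A) :
    ((fibreCocone (genericTrans hT hT') X).comparison C).IsEquivalence := by
  apply Cocone.comparison_isEquivalence
  · intro m
    exact (genericOb hT ⟨X, m.as⟩).isLaxGeneric
  · intro m n u
    rw [fibreCocone_genericTrans_cell]
    exact Components.isGenericCell_vertCell (x := genericOb hT ⟨X, m.as⟩)
      (x' := genericOb hT ⟨X, n.as⟩) _
  · intro m n u u' l h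
    rw [fibreCocone_genericTrans_cell, fibreCocone_genericTrans_cell] at h
    have h1 := Components.eq_of_vertCell (x := genericOb hT ⟨X, m.as⟩)
      (x' := genericOb hT ⟨X, n.as⟩) l h
    have h2 := ((genericTot_inclMap hT u).symm.trans h1).trans (genericTot_inclMap hT u')
    exact congrArg Discrete.mk h2
  · intro m n h γ
    let u : m ⟶ n := ⟨Components.mk (δ := (genericOb hT ⟨X, m.as⟩).arr)
      (z := 𝟙 X ≫ (genericOb hT ⟨X, n.as⟩).arr) (γ ≫ (λ_ (genericOb hT ⟨X, n.as⟩).arr).inv)⟩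
    obtain ⟨l, hl⟩ := Components.exists_vertCell (x := genericOb hT ⟨X, m.as⟩)
      (x' := genericOb hT ⟨X, n.as⟩) γ
      (genericTot hT (El.inclMap (genericDisplayed hT).fibres u.as)) (genericTot_inclMap hT u)
    exact ⟨u, l, (congrArg _ (fibreCocone_genericTrans_cell hT hT' u)).trans hl⟩
  · intro C y
    obtain ⟨x, f, e⟩ := exists_laxGeneric hT y
    exact ⟨⟨x⟩, f, e⟩

end Backward

end LaxFamilial

/-- The universes are those of the fibres constructed from (a): an object is an object of `A` with a
1-cell of `B`, and a morphism is a class of pairs of a 1-cell of `A` and a 2-cell of `B`. -/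
theorem theorem4 {A : Type u₁} [Bicategory.{w₁, v₁} A] {B : Type u₂} [Bicategory.{w₂, v₂} B]
    (T : A ⥤ᵖ B) :
    LaxFamilial.IsLaxFamilial.{w₁, w₂, v₁, v₂, u₁, u₂, max v₁ w₂, max u₁ v₂} T ↔
      LaxFamilial.AdmitsLaxGenericFactorizations T ∧ LaxFamilial.GenericCellsCompose T :=
  ⟨fun h => ⟨h.admitsLaxGenericFactorizations, h.genericCellsCompose⟩, fun ⟨h, h'⟩ =>
    ⟨_, _, LaxFamilial.genericTrans h h', fun _ _ φ => LaxFamilial.isIso_genericTrans h h' φ,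
      LaxFamilial.isEquivalence_genericTrans h h'⟩⟩
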